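/- Let $F\in C^\infty(\mathbb R^3)$ be such that $\sup_{(x,y)\in K,\,z\in\mathbb R}|\partial_zF(x,y,z)|<\infty$ for every compact $K\subset\mathbb R^2$, let $\varphi,\psi\in C^\infty(\mathbb R)$, and let $f\in C^\infty(\mathbb R)$ satisfy $f'(x)\neq 0$ for all $x\in\mathbb R$ and $f(\mathbb R)=\mathbb R$. For $h\in C^\infty(\mathbb R)$ let $(P_h)$ denote the Cauchy problem $$\frac{\partial^2u}{\partial x\partial y}=F(x,y,u),\qquad u(x,h(x))=\varphi(x),\qquad \frac{\partial u}{\partial y}(x,h(x))=\psi(x)$$ for $u\in C^\infty(\mathbb R^2)$. For $d=1,2$ let $\mathcal X^s(\mathbb R^d)$ be the algebra of families $(u_\varepsilon)_{\varepsilon\in(0,1]}$ in $C^\infty(\mathbb R^d)$ such that for each compact $K$ and each multi-index $\alpha$ there is $p\in\mathbb N$ with $\sup_K|D^\alpha u_\varepsilon|=O(\varepsilon^{-p})$ as $\varepsilon\to0$, let $\mathcal N^s(\mathbb R^d)$ be the ideal of those with $\sup_K|D^\alpha u_\varepsilon|=O(\varepsilon^{q})$ for all $K$, $\alpha$ and all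 $q\in\mathbb N$, and let $\mathcal G^s(\mathbb R^d)=\mathcal X^s(\mathbb R^d)/\mathcal N^s(\mathbb R^d)$ be the simplified Colombeau algebra. Smooth functions are regarded as elements of $\mathcal G^s(\mathbb R^d)$ through constant families. Then $(P_f)$ has exactly one solution $v\in C^\infty(\mathbb R^2)$. Moreover, let $(f_\varepsilon)_\varepsilon\in\mathcal X^s(\mathbb R)$ be any representative of $[f]$, that is, $[f_\varepsilon]=[f]$ in $\mathcal G^s(\mathbb R)$. Call $U\in\mathcal G^s(\mathbb R^2)$ a generalized solution along $(f_\varepsilon)_\varepsilon$ if it has a representative $(u_\varepsilon)_\varepsilon$ such that the families $\partial^2_{xy}u_\varepsilon-F(\cdot,\cdot,u_\varepsilon)$, $u_\varepsilon(\cdot,f_\varepsilon(\cdot))-\varphi$ and $\partial_yu_\varepsilon(\cdot,f_\varepsilon(\cdot))-\psi$ are negligible (that is, lie in $\mathcal N^s(\mathbb R^2)$, $\mathcal N^s(\mathbb R)$ and $\mathcal N^s(\mathbb R)$, respectively). Then: 1. for each $\varepsilon\in(0,1]$ with $f_\varepsilon(\mathbb R)=\mathbb R$ and $f_\varepsilon'(x)\neq0$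 for all $x$, the problem $(P_{f_\varepsilon})$ has exactly one solution in $C^\infty(\mathbb R^2)$; 2. if $u_\varepsilon\in C^\infty(\mathbb R^2)$ solves $(P_{f_\varepsilon})$ for every $\varepsilon\in(0,1]$, then $(u_\varepsilon)_\varepsilon\in\mathcal X^s(\mathbb R^2)$, the class $[u_\varepsilon]$ is a generalized solution along $(f_\varepsilon)_\varepsilon$, and $[u_\varepsilon]=[v]$ in $\mathcal G^s(\mathbb R^2)$; 3. every generalized solution $U\in\mathcal G^s(\mathbb R^2)$ along $(f_\varepsilon)_\varepsilon$ equals $[v]$. -/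

import Mathlib

open scoped ContDiff

namespace Colombeau

/-- The index set `Λ = (0,1]`. -/
abbrev Idx : Type := Set.Ioc (0 : ℝ) 1

section Algebra

variable (E : Type) [NormedAddCommGroup E] [NormedSpace ℝ E]

/-- The algebra of smooth real functions on `E`. -/
def Smooth : Subalgebra ℝ (E → ℝ) where
  carrier := {u | ContDiff ℝ ∞ u}
  mul_mem' := fun {_ _} hu hv => ContDiff.mul (𝕜 := ℝ) (n := ∞) hu hv
  add_mem' := fun {_ _} hu hv => ContDiff.add (𝕜 := ℝ) (n := ∞) hu hv
  algebraMap_mem' := fun r => (contDiff_const : ContDiff ℝ ∞ fun _ : E => r)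

variable {E}

theorem contDiff_coe (u : Smooth E) : ContDiff ℝ ∞ (u : E → ℝ) := u.2

/-- Moderate growth: for every compact `K` and every order `l`,
`sup_K |D^l u_ε| ≤ C ε^{-p}` for some `p`, `C` and all small `ε`. -/
def IsModerate (u : Idx → E → ℝ) : Prop :=
  ∀ K : Set E, IsCompact K → ∀ l : ℕ, ∃ p : ℕ, ∃ C > (0 : ℝ), ∃ μ > (0 : ℝ),
    ∀ ε : Idx, (ε : ℝ) ≤ μ → ∀ x ∈ K, ‖iteratedFDeriv ℝ l (u ε) x‖ ≤ C / (ε : ℝ) ^ p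

/-- Negligibility: for every compact `K`, every order `l` and every `q`,
`sup_K |D^l u_ε| ≤ D ε^q` for some `D` and all small `ε`. -/
def IsNegligible (u : Idx → E → ℝ) : Prop :=
  ∀ K : Set E, IsCompact K → ∀ l q : ℕ, ∃ D > (0 : ℝ), ∃ μ > (0 : ℝ),
    ∀ ε : Idx, (ε : ℝ) ≤ μ → ∀ x ∈ K, ‖iteratedFDeriv ℝ l (u ε) x‖ ≤ D * (ε : ℝ) ^ q

theorem continuous_iteratedFDeriv_coe (u : Smooth E) (l : ℕ) :
    Continuous (iteratedFDeriv ℝ l (u : E → ℝ)) :=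
  (contDiff_coe u).continuous_iteratedFDeriv (by exact_mod_cast le_top)

theorem isModerate_const (u : Smooth E) : IsModerate (fun _ : Idx => (u : E → ℝ)) := by
  intro K hK l
  obtain ⟨C, hC⟩ := hK.exists_bound_of_continuousOn (continuous_iteratedFDeriv_coe u l).continuousOn
  refine ⟨0, |C| + 1, by positivity, 1, one_pos, fun ε _ x hx => ?_⟩
  have h1 := hC x hx
  have h2 := le_abs_self C
  simp only [pow_zero, div_one]
  linarith

theorem IsModerate.add {u v : Idx → Smooth E} (hu : IsModerate fun ε => (u ε : E → ℝ))
    (hv : IsModerate fun ε => (v ε : E → ℝ)) :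
    IsModerate fun ε => ((u ε : E → ℝ) + (v ε : E → ℝ)) := by
  intro K hK l
  obtain ⟨p, C, hC, μ, hμ, h⟩ := hu K hK l
  obtain ⟨p', C', hC', μ', hμ', h'⟩ := hv K hK l
  refine ⟨p + p', C + C', by positivity, min μ μ', lt_min hμ hμ', fun ε hε x hx => ?_⟩
  have h1 := h ε (hε.trans (min_le_left _ _)) x hx
  have h2 := h' ε (hε.trans (min_le_right _ _)) x hx
  have e0 : (0 : ℝ) < ε := ε.2.1
  have e1 : (ε : ℝ) ≤ 1 := ε.2.2
  rw [iteratedFDeriv_add_apply ((contDiff_coe (u ε)).contDiffAt.of_le (by exact_mod_cast le_top))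
    ((contDiff_coe (v ε)).contDiffAt.of_le (by exact_mod_cast le_top))]
  have k1 : C / (ε : ℝ) ^ p ≤ C / (ε : ℝ) ^ (p + p') :=
    div_le_div_of_nonneg_left hC.le (by positivity)
      (pow_le_pow_of_le_one e0.le e1 (Nat.le_add_right _ _))
  have k2 : C' / (ε : ℝ) ^ p' ≤ C' / (ε : ℝ) ^ (p + p') :=
    div_le_div_of_nonneg_left hC'.le (by positivity)
      (pow_le_pow_of_le_one e0.le e1 (Nat.le_add_left _ _))
  rw [add_div]
  exact (norm_add_le _ _).trans (add_le_add (h1.trans k1) (h2.trans k2))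

theorem IsNegligible.add {u v : Idx → Smooth E} (hu : IsNegligible fun ε => (u ε : E → ℝ))
    (hv : IsNegligible fun ε => (v ε : E → ℝ)) :
    IsNegligible fun ε => ((u ε : E → ℝ) + (v ε : E → ℝ)) := by
  intro K hK l q
  obtain ⟨C, hC, μ, hμ, h⟩ := hu K hK l q
  obtain ⟨C', hC', μ', hμ', h'⟩ := hv K hK l q
  refine ⟨C + C', by positivity, min μ μ', lt_min hμ hμ', fun ε hε x hx => ?_⟩
  have h1 := h ε (hε.trans (min_le_left _ _)) x hx
  have h2 := h' ε (hε.trans (min_le_right _ _)) x hx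
  rw [iteratedFDeriv_add_apply ((contDiff_coe (u ε)).contDiffAt.of_le (by exact_mod_cast le_top))
    ((contDiff_coe (v ε)).contDiffAt.of_le (by exact_mod_cast le_top)), add_mul]
  exact (norm_add_le _ _).trans (add_le_add h1 h2)

/-- A single bound for all derivatives of order at most `l` of a moderate family. -/
theorem IsModerate.uniform {u : Idx → E → ℝ} (hu : IsModerate u) {K : Set E} (hK : IsCompact K)
    (l : ℕ) : ∃ p : ℕ, ∃ C > (0 : ℝ), ∃ μ > (0 : ℝ), ∀ ε : Idx, (ε : ℝ) ≤ μ → ∀ x ∈ K,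
      ∀ i ≤ l, ‖iteratedFDeriv ℝ i (u ε) x‖ ≤ C / (ε : ℝ) ^ p := by
  induction l with
  | zero =>
    obtain ⟨p, C, hC, μ, hμ, h⟩ := hu K hK 0
    refine ⟨p, C, hC, μ, hμ, fun ε hε x hx i hi => ?_⟩
    obtain rfl : i = 0 := by omega
    exact h ε hε x hx
  | succ l ih =>
    obtain ⟨p, C, hC, μ, hμ, h⟩ := hu K hK (l + 1)
    obtain ⟨p', C', hC', μ', hμ', h'⟩ := ih
    refine ⟨p + p', C + C', by positivity, min μ μ', lt_min hμ hμ', fun ε hε x hx i hi => ?_⟩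
    have e0 : (0 : ℝ) < ε := ε.2.1
    have e1 : (ε : ℝ) ≤ 1 := ε.2.2
    have k1 : C / (ε : ℝ) ^ p ≤ C / (ε : ℝ) ^ (p + p') :=
      div_le_div_of_nonneg_left hC.le (by positivity)
        (pow_le_pow_of_le_one e0.le e1 (Nat.le_add_right _ _))
    have k2 : C' / (ε : ℝ) ^ p' ≤ C' / (ε : ℝ) ^ (p + p') :=
      div_le_div_of_nonneg_left hC'.le (by positivity)
        (pow_le_pow_of_le_one e0.le e1 (Nat.le_add_left _ _))
    have p1 : 0 < C / (ε : ℝ) ^ (p + p') := by positivity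
    have p2 : 0 < C' / (ε : ℝ) ^ (p + p') := by positivity
    rw [add_div]
    rcases Nat.lt_or_ge l i with hli | hli
    · obtain rfl : i = l + 1 := by omega
      have := h ε (hε.trans (min_le_left _ _)) x hx
      linarith
    · have := h' ε (hε.trans (min_le_right _ _)) x hx i hli
      linarith

theorem IsNegligible.uniform {u : Idx → E → ℝ} (hu : IsNegligible u) {K : Set E}
    (hK : IsCompact K) (l q : ℕ) : ∃ D > (0 : ℝ), ∃ μ > (0 : ℝ), ∀ ε : Idx, (ε : ℝ) ≤ μ →
      ∀ x ∈ K, ∀ i ≤ l, ‖iteratedFDeriv ℝ i (u ε) x‖ ≤ D * (ε : ℝ) ^ q := by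
  induction l with
  | zero =>
    obtain ⟨C, hC, μ, hμ, h⟩ := hu K hK 0 q
    refine ⟨C, hC, μ, hμ, fun ε hε x hx i hi => ?_⟩
    obtain rfl : i = 0 := by omega
    exact h ε hε x hx
  | succ l ih =>
    obtain ⟨C, hC, μ, hμ, h⟩ := hu K hK (l + 1) q
    obtain ⟨C', hC', μ', hμ', h'⟩ := ih
    refine ⟨C + C', by positivity, min μ μ', lt_min hμ hμ', fun ε hε x hx i hi => ?_⟩
    have e0 : (0 : ℝ) < ε := ε.2.1
    have p1 : 0 < C * (ε : ℝ) ^ q := by positivity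
    have p2 : 0 < C' * (ε : ℝ) ^ q := by positivity
    rw [add_mul]
    rcases Nat.lt_or_ge l i with hli | hli
    · obtain rfl : i = l + 1 := by omega
      have := h ε (hε.trans (min_le_left _ _)) x hx
      linarith
    · have := h' ε (hε.trans (min_le_right _ _)) x hx i hli
      linarith

/-- Leibniz bound used for both product estimates. -/
theorem norm_iteratedFDeriv_mul_le_of_le (u v : Smooth E) (l : ℕ) (x : E) {a b : ℝ}
    (ha : ∀ i ≤ l, ‖iteratedFDeriv ℝ i (u : E → ℝ) x‖ ≤ a)
    (hb : ∀ i ≤ l, ‖iteratedFDeriv ℝ i (v : E → ℝ) x‖ ≤ b) :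
    ‖iteratedFDeriv ℝ l ((u : E → ℝ) * (v : E → ℝ)) x‖ ≤ 2 ^ l * (a * b) := by
  have a0 : 0 ≤ a := (norm_nonneg _).trans (ha 0 (Nat.zero_le _))
  have key := norm_iteratedFDeriv_mul_le (𝕜 := ℝ) (N := ∞) (contDiff_coe u) (contDiff_coe v) x
    (n := l) (by exact_mod_cast le_top)
  calc ‖iteratedFDeriv ℝ l ((u : E → ℝ) * (v : E → ℝ)) x‖
      ≤ ∑ i ∈ Finset.range (l + 1), (l.choose i : ℝ) * ‖iteratedFDeriv ℝ i (u : E → ℝ) x‖ *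
          ‖iteratedFDeriv ℝ (l - i) (v : E → ℝ) x‖ := key
    _ ≤ ∑ i ∈ Finset.range (l + 1), (l.choose i : ℝ) * (a * b) := by
        refine Finset.sum_le_sum fun i hi => ?_
        have hi' : i ≤ l := Nat.lt_succ_iff.mp (Finset.mem_range.mp hi)
        rw [mul_assoc]
        exact mul_le_mul_of_nonneg_left
          (mul_le_mul (ha i hi') (hb _ (Nat.sub_le _ _)) (norm_nonneg _) a0) (Nat.cast_nonneg _)
    _ = 2 ^ l * (a * b) := by
        rw [← Finset.sum_mul]
        congr 1
        exact_mod_cast Nat.sum_range_choose l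

theorem IsModerate.mul {u v : Idx → Smooth E} (hu : IsModerate fun ε => (u ε : E → ℝ))
    (hv : IsModerate fun ε => (v ε : E → ℝ)) :
    IsModerate fun ε => ((u ε : E → ℝ) * (v ε : E → ℝ)) := by
  intro K hK l
  obtain ⟨p, C, hC, μ, hμ, h⟩ := hu.uniform hK l
  obtain ⟨p', C', hC', μ', hμ', h'⟩ := hv.uniform hK l
  refine ⟨p + p', 2 ^ l * (C * C'), by positivity, min μ μ', lt_min hμ hμ', fun ε hε x hx => ?_⟩
  have key := norm_iteratedFDeriv_mul_le_of_le (u ε) (v ε) l x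
    (h ε (hε.trans (min_le_left _ _)) x hx) (h' ε (hε.trans (min_le_right _ _)) x hx)
  rwa [div_mul_div_comm, ← pow_add, ← mul_div_assoc] at key

theorem IsNegligible.moderate_mul {u v : Idx → Smooth E}
    (hu : IsModerate fun ε => (u ε : E → ℝ)) (hv : IsNegligible fun ε => (v ε : E → ℝ)) :
    IsNegligible fun ε => ((u ε : E → ℝ) * (v ε : E → ℝ)) := by
  intro K hK l q
  obtain ⟨p, C, hC, μ, hμ, h⟩ := hu.uniform hK l
  obtain ⟨D, hD, μ', hμ', h'⟩ := hv.uniform hK l (q + p)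
  refine ⟨2 ^ l * (C * D), by positivity, min μ μ', lt_min hμ hμ', fun ε hε x hx => ?_⟩
  have e0 : (0 : ℝ) < ε := ε.2.1
  have key := norm_iteratedFDeriv_mul_le_of_le (u ε) (v ε) l x
    (h ε (hε.trans (min_le_left _ _)) x hx) (h' ε (hε.trans (min_le_right _ _)) x hx)
  have e : (2 : ℝ) ^ l * (C / (ε : ℝ) ^ p * (D * (ε : ℝ) ^ (q + p)))
      = 2 ^ l * (C * D) * (ε : ℝ) ^ q := by
    rw [pow_add]
    field_simp
  rwa [e] at key

theorem isNegligible_zero : IsNegligible (fun _ : Idx => (0 : E → ℝ)) := by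
  intro K _ l q
  refine ⟨1, one_pos, 1, one_pos, fun ε _ x _ => ?_⟩
  have e0 : (0 : ℝ) < ε := ε.2.1
  rw [iteratedFDeriv_zero]
  simp only [Pi.zero_apply, norm_zero]
  positivity

variable (E)

/-- The algebra `X^s(E)` of moderate families of smooth functions. -/
def Moderate : Subalgebra ℝ (Idx → Smooth E) where
  carrier := {u | IsModerate fun ε => (u ε : E → ℝ)}
  mul_mem' := fun {_ _} hu hv => IsModerate.mul hu hv
  add_mem' := fun {_ _} hu hv => IsModerate.add hu hv
  algebraMap_mem' := fun r => isModerate_const (algebraMap ℝ (Smooth E) r)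

instance instCommRingModerate : CommRing (Moderate E) := Subalgebra.toCommRing (Moderate E)

/-- The ideal `N^s(E)` of negligible families. -/
def Negligible : Ideal (Moderate E) where
  carrier := {u | IsNegligible fun ε => ((u : Idx → Smooth E) ε : E → ℝ)}
  zero_mem' := isNegligible_zero
  add_mem' := fun {_ _} hu hv => IsNegligible.add hu hv
  smul_mem' := fun c _ hu => IsNegligible.moderate_mul c.2 hu

/-- The simplified Colombeau algebra `G^s(E) = X^s(E) / N^s(E)`. -/
abbrev Gs : Type := Moderate E ⧸ Negligible E

variable {E}

/-- The class `[u_ε]` of a moderate family. -/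
def cls (u : Moderate E) : Gs E := Ideal.Quotient.mk (Negligible E) u

/-- A smooth function viewed as a generalized function through the constant family. -/
def ofSmooth (u : Smooth E) : Gs E := cls ⟨fun _ => u, isModerate_const u⟩

end Algebra

section Cauchy

/-- `∂u/∂y`. -/
noncomputable def dy (u : ℝ × ℝ → ℝ) (x y : ℝ) : ℝ := deriv (fun t => u (x, t)) y

/-- `∂²u/∂x∂y`. -/
noncomputable def dxdy (u : ℝ × ℝ → ℝ) (x y : ℝ) : ℝ := deriv (fun s => dy u s y) x

/-- Non-characteristic curves `y = f(x)`: `f` is smooth with nowhere vanishing derivative and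
`f(ℝ) = ℝ`. -/
def IsNonCharacteristic (f : Smooth ℝ) : Prop :=
  (∀ x, deriv (f : ℝ → ℝ) x ≠ 0) ∧ Function.Surjective (f : ℝ → ℝ)

/-- `u` is a smooth solution on `ℝ²` of the Cauchy problem
`∂²u/∂x∂y = F(x, y, u)`, `u(x, f(x)) = φ(x)`, `∂u/∂y (x, f(x)) = ψ(x)`. -/
def IsSolution (F : Smooth (ℝ × ℝ × ℝ)) (φ ψ f : Smooth ℝ) (u : Smooth (ℝ × ℝ)) : Prop :=
  (∀ x y, dxdy u x y = F.1 (x, y, u.1 (x, y))) ∧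
  (∀ x, u.1 (x, f.1 x) = φ.1 x) ∧
  (∀ x, dy u x (f.1 x) = ψ.1 x)

/-- `U ∈ G^s(ℝ²)` solves the generalized Cauchy problem along the curves `y = f_ε(x)`: some
representative satisfies the equation and both initial conditions up to negligible families. -/
def IsGeneralizedSolution (F : Smooth (ℝ × ℝ × ℝ)) (φ ψ : Smooth ℝ) (f : Idx → Smooth ℝ)
    (U : Gs (ℝ × ℝ)) : Prop :=
  ∃ u : Moderate (ℝ × ℝ), cls u = U ∧
    IsNegligible (fun ε (p : ℝ × ℝ) =>
      dxdy (u.1 ε) p.1 p.2 - F.1 (p.1, p.2, (u.1 ε).1 p)) ∧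
    IsNegligible (fun ε (x : ℝ) => (u.1 ε).1 (x, (f ε).1 x) - φ.1 x) ∧
    IsNegligible (fun ε (x : ℝ) => dy (u.1 ε) x ((f ε).1 x) - ψ.1 x)

end Cauchy

end Colombeau

/-! Existence comes from straightening the curve. With y = f(t) the data move to the diagonal, the
equation becomes U_xt = f'(t) F(x, f(t), U), and the problem turns into a Volterra equation over the
triangle between a point and the diagonal. The bound on ∂F/∂z is uniform in z, so the right-hand
side is globally Lipschitz in U over each square. Picard iteration therefore converges on the whole
plane (`exists_fixedPoint`), and the integral formulas for the partial derivatives give smoothness.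

The rest of the theorem follows from one stability estimate, `IsCurveFamily.isNegligible_sub`. For
an approximate solution u_ε along y = f_ε(x), the difference w = u_ε - v satisfies w_xy = F(x, y, v
+ w) - F(x, y, v) + (negligible). Its data on y = f_ε(x) are negligible, because v is a fixed smooth
function and f_ε - f is negligible. A Gronwall bound (`abs_le_of_goursat`) controls w itself.
Derivatives follow by induction: if w is O(ε^q) up to order k, so is w_xy (`BigO.substitute`).
Integrating from the curve (`bigO_of_partialX`, `bigO_of_partialY`) then gives the same for w_x and
w_y, that is, one more order for w.

F is expanded only around v, so moderateness of u_ε is never an input: exact solutions turn out to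
be moderate, and classical uniqueness is the case of constant families. The single f_ε need not be
non-characteristic either. For small ε, over a compact set, the curve stays in a fixed box, crosses
every horizontal line that is needed, and has slope bounded away from zero. -/

namespace Colombeau

/-! ### Weighted primitives and integrals depending on a parameter -/

section Calculus

open MeasureTheory intervalIntegral

/-- Weighted estimate of a primitive: the weight `e^{l|s-a|}` gains a factor `1/l`. -/
theorem abs_integral_le_exp {l M a b : ℝ} (hl : 0 < l) (hM : 0 ≤ M) {g : ℝ → ℝ}
    (hg : ∀ s ∈ Set.uIcc a b, |g s| ≤ M * Real.exp (l * |s - a|)) :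
    |∫ s in a..b, g s| ≤ M / l * Real.exp (l * |b - a|) := by
  have key : ∀ (a b : ℝ) (g : ℝ → ℝ), a ≤ b →
      (∀ s ∈ Set.Icc a b, |g s| ≤ M * Real.exp (l * |s - a|)) →
      |∫ s in a..b, g s| ≤ M / l * Real.exp (l * |b - a|) := by
    intro a b g hab hg
    have hd : ∀ s ∈ Set.uIcc a b, HasDerivAt (fun s => M / l * Real.exp (l * (s - a)))
        (M * Real.exp (l * (s - a))) s := by
      intro s _
      have := ((((hasDerivAt_id s).sub_const a).const_mul l).exp).const_mul (M / l)
      refine this.congr_deriv ?_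
      simp only [id]
      field_simp
    have hc : Continuous fun s => M * Real.exp (l * (s - a)) := by fun_prop
    have h1 : ‖∫ s in a..b, g s‖ ≤ ∫ s in a..b, M * Real.exp (l * (s - a)) := by
      refine norm_integral_le_of_norm_le hab (Filter.Eventually.of_forall fun s hs => ?_)
        (hc.intervalIntegrable _ _)
      have := hg s ⟨hs.1.le, hs.2⟩
      rwa [abs_of_nonneg (sub_nonneg.2 hs.1.le)] at this
    rw [integral_eq_sub_of_hasDerivAt hd (hc.intervalIntegrable _ _)] at h1
    rw [Real.norm_eq_abs] at h1
    rw [abs_of_nonneg (sub_nonneg.2 hab)]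
    have : 0 ≤ M / l * Real.exp (l * (a - a)) := by positivity
    linarith
  rcases le_total a b with hab | hab
  · exact key a b g hab (by rwa [Set.uIcc_of_le hab] at hg)
  · have := key (-a) (-b) (fun s => g (-s)) (by linarith) (by
      intro s hs
      have h := hg (-s) (by rw [Set.uIcc_of_ge hab]; constructor <;> linarith [hs.1, hs.2])
      have e : |-s - a| = |s - -a| := by rw [← abs_neg]; congr 1; ring
      rwa [e] at h)
    rw [integral_comp_neg, neg_neg, neg_neg, integral_symm, abs_neg] at this
    have e : |-b - -a| = |b - a| := by rw [← abs_neg]; congr 1; ring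
    rwa [e] at this

theorem hasStrictFDerivAt_of_partial {u p q : ℝ × ℝ → ℝ} (hp : Continuous p) (hq : Continuous q)
    (hx : ∀ x y, HasDerivAt (fun s => u (s, y)) (p (x, y)) x)
    (hy : ∀ x y, HasDerivAt (fun t => u (x, t)) (q (x, y)) y) (z : ℝ × ℝ) :
    HasStrictFDerivAt u (p z • ContinuousLinearMap.fst ℝ ℝ ℝ +
      q z • ContinuousLinearMap.snd ℝ ℝ ℝ) z := by
  have h := hasStrictFDerivAt_uncurry_coprod (𝕜 := ℝ) (u := z) (f := fun x y => u (x, y))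
    (f₁ := fun x y => ContinuousLinearMap.toSpanSingleton ℝ (p (x, y)))
    (f₂ := fun x y => ContinuousLinearMap.toSpanSingleton ℝ (q (x, y)))
    (Filter.Eventually.of_forall fun v => (hx v.1 v.2).hasFDerivAt)
    (Filter.Eventually.of_forall fun v => (hy v.1 v.2).hasFDerivAt)
    (by
      have : Continuous fun v : ℝ × ℝ => ContinuousLinearMap.toSpanSingleton ℝ (p v) :=
        (ContinuousLinearMap.toSpanSingletonCLE (𝕜 := ℝ) (E := ℝ)).continuous.comp hp
      exact this.continuousAt)
    (by
      have : Continuous fun v : ℝ × ℝ => ContinuousLinearMap.toSpanSingleton ℝ (q v) :=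
        (ContinuousLinearMap.toSpanSingletonCLE (𝕜 := ℝ) (E := ℝ)).continuous.comp hq
      exact this.continuousAt)
  refine h.congr_fderiv ?_
  ext <;> simp [Function.HasUncurry.uncurry]

theorem contDiff_succ_of_partial {u p q : ℝ × ℝ → ℝ} {n : ℕ} (hp : ContDiff ℝ n p)
    (hq : ContDiff ℝ n q) (hx : ∀ x y, HasDerivAt (fun s => u (s, y)) (p (x, y)) x)
    (hy : ∀ x y, HasDerivAt (fun t => u (x, t)) (q (x, y)) y) :
    ContDiff ℝ (n + 1 : ℕ) u := by
  have h := hasStrictFDerivAt_of_partial hp.continuous hq.continuous hx hy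
  push_cast
  rw [contDiff_succ_iff_fderiv]
  refine ⟨fun z => (h z).hasFDerivAt.differentiableAt, by simp, ?_⟩
  rw [show fderiv ℝ u = _ from funext fun z => (h z).hasFDerivAt.fderiv]
  exact (hp.smul contDiff_const).add (hq.smul contDiff_const)

theorem hasDerivAt_integral_param {h h₁ : ℝ × ℝ → ℝ} (hc : Continuous h) (hc₁ : Continuous h₁)
    (hd : ∀ x t, HasDerivAt (fun s => h (s, t)) (h₁ (x, t)) x) (a b x : ℝ) :
    HasDerivAt (fun x => ∫ t in a..b, h (x, t)) (∫ t in a..b, h₁ (x, t)) x := by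
  have hK : IsCompact (Metric.closedBall x 1 ×ˢ Set.uIcc a b) :=
    (isCompact_closedBall x 1).prod isCompact_uIcc
  obtain ⟨C, hC⟩ := hK.exists_bound_of_continuousOn hc₁.continuousOn
  refine (intervalIntegral.hasDerivAt_integral_of_dominated_loc_of_deriv_le (F := fun x t => h (x, t))
    (F' := fun x t => h₁ (x, t)) (bound := fun _ => C)
    (Metric.closedBall_mem_nhds x one_pos) ?_ ?_ ?_ ?_ ?_ ?_).2
  · exact Filter.Eventually.of_forall fun s =>
      (hc.comp (by fun_prop : Continuous fun t : ℝ => (s, t))).aestronglyMeasurable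
  · exact (hc.comp (by fun_prop : Continuous fun t : ℝ => (x, t))).intervalIntegrable _ _
  · exact (hc₁.comp (by fun_prop : Continuous fun t : ℝ => (x, t))).aestronglyMeasurable
  · exact Filter.Eventually.of_forall fun t ht s hs => hC (s, t) ⟨hs, Set.uIoc_subset_uIcc ht⟩
  · exact intervalIntegrable_const
  · exact Filter.Eventually.of_forall fun t _ s _ => hd s t

theorem continuous_integral_diag {h : ℝ × ℝ → ℝ} (hc : Continuous h) :
    Continuous fun z : ℝ × ℝ => ∫ t in z.1..z.2, h (z.1, t) := by
  have e : ∀ z : ℝ × ℝ, ∫ t in z.1..z.2, h (z.1, t)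
      = (∫ t in (0 : ℝ)..z.2, h (z.1, t)) - ∫ t in (0 : ℝ)..z.1, h (z.1, t) := fun z =>
    (integral_interval_sub_left
      ((hc.comp (by fun_prop : Continuous fun t : ℝ => (z.1, t))).intervalIntegrable _ _)
      ((hc.comp (by fun_prop : Continuous fun t : ℝ => (z.1, t))).intervalIntegrable _ _)).symm
  simp_rw [e]
  have hu : Continuous (Function.uncurry fun (z : ℝ × ℝ) (t : ℝ) => h (z.1, t)) :=
    hc.comp (by fun_prop : Continuous fun q : (ℝ × ℝ) × ℝ => (q.1.1, q.2))
  exact (continuous_parametric_intervalIntegral_of_continuous hu continuous_snd).sub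
    (continuous_parametric_intervalIntegral_of_continuous hu continuous_fst)

/-- Leibniz rule with the parameter also as lower end of the interval of integration. -/
theorem hasDerivAt_integral_diag {h h₁ : ℝ × ℝ → ℝ} (hc : Continuous h) (hc₁ : Continuous h₁)
    (hd : ∀ x t, HasDerivAt (fun s => h (s, t)) (h₁ (x, t)) x) (b x : ℝ) :
    HasDerivAt (fun x => ∫ t in x..b, h (x, t)) (-h (x, x) + ∫ t in x..b, h₁ (x, t)) x := by
  have hcx : ∀ x : ℝ, Continuous fun t => h (x, t) := fun x =>
    hc.comp (by fun_prop : Continuous fun t : ℝ => (x, t))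
  have hu : Continuous (Function.uncurry fun (z : ℝ × ℝ) (t : ℝ) => h₁ (z.2, t)) :=
    hc₁.comp (by fun_prop : Continuous fun q : (ℝ × ℝ) × ℝ => (q.1.2, q.2))
  have hq : Continuous fun z : ℝ × ℝ => ∫ t in z.1..b, h₁ (z.2, t) := by
    have e : ∀ z : ℝ × ℝ, ∫ t in z.1..b, h₁ (z.2, t) = -∫ t in b..z.1, h₁ (z.2, t) :=
      fun z => integral_symm _ _
    simp_rw [e]
    exact (continuous_parametric_intervalIntegral_of_continuous hu continuous_fst).neg
  -- The lower end and the parameter are treated as independent variables z.1 and z.2; the chain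
  -- rule along z = (x, x) then gives the total derivative.
  have hs := hasStrictFDerivAt_of_partial (u := fun z => ∫ t in z.1..b, h (z.2, t))
    (p := fun z => -h (z.2, z.1)) (q := fun z => ∫ t in z.1..b, h₁ (z.2, t))
    (hc.comp continuous_swap).neg hq
    (fun a x => integral_hasDerivAt_left ((hcx x).intervalIntegrable _ _)
      (hcx x).aestronglyMeasurable.stronglyMeasurableAtFilter (hcx x).continuousAt)
    (fun a x => hasDerivAt_integral_param hc hc₁ hd a b x) (x, x)
  have := HasFDerivAt.comp_hasDerivAt (f := fun x : ℝ => (x, x)) x hs.hasFDerivAt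
    ((hasDerivAt_id x).prodMk (hasDerivAt_id x))
  refine this.congr_deriv ?_
  simp

/-- The y-derivative is h itself, and the x-derivative is a boundary term plus an integral of the
same form with ∂h/∂x in place of h. Induction on the order therefore closes. -/
theorem contDiff_integral_diag (n : ℕ) : ∀ {h : ℝ × ℝ → ℝ}, ContDiff ℝ n h →
    ContDiff ℝ n fun z : ℝ × ℝ => ∫ t in z.1..z.2, h (z.1, t) := by
  induction n with
  | zero =>
    intro h hh
    exact contDiff_zero.2 (continuous_integral_diag hh.continuous)
  | succ n ih =>
    intro h hh
    have hdiff : Differentiable ℝ h := hh.differentiable (by simp)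
    have h1 : ContDiff ℝ n fun z => fderiv ℝ h z (1, 0) :=
      (hh.fderiv_right (m := n) (by push_cast; exact le_rfl)).clm_apply contDiff_const
    have hn : ContDiff ℝ n h := hh.of_le (by push_cast; exact le_self_add)
    have hd : ∀ x t, HasDerivAt (fun s => h (s, t)) (fderiv ℝ h (x, t) (1, 0)) x := fun x t =>
      (hdiff (x, t)).hasFDerivAt.comp_hasDerivAt x
        ((hasDerivAt_id x).prodMk (hasDerivAt_const x t))
    have hcx : ∀ x : ℝ, Continuous fun t => h (x, t) := fun x =>
      hh.continuous.comp (by fun_prop : Continuous fun t : ℝ => (x, t))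
    refine contDiff_succ_of_partial (p := fun z => -h (z.1, z.1) +
      ∫ t in z.1..z.2, fderiv ℝ h (z.1, t) (1, 0)) (q := h) ?_ hn ?_ ?_
    · exact (hn.comp (contDiff_fst.prodMk contDiff_fst)).neg.add (ih h1)
    · exact fun x y => hasDerivAt_integral_diag hh.continuous h1.continuous hd y x
    · exact fun x y => integral_hasDerivAt_right ((hcx x).intervalIntegrable _ _)
        (hcx x).aestronglyMeasurable.stronglyMeasurableAtFilter (hcx x).continuousAt

end Calculus

/-! ### Existence by Picard iteration and straightening of the curve -/

section Existence

open MeasureTheory intervalIntegral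

/-- The double integral `∫_x^y ∫_t^x h(s,t) ds dt` over the triangle cut off by the diagonal. -/
noncomputable def triangleIntegral (h : ℝ × ℝ → ℝ) (z : ℝ × ℝ) : ℝ :=
  ∫ t in z.1..z.2, ∫ s in t..z.1, h (s, t)

theorem contDiff_integral_swap (n : ℕ) {h : ℝ × ℝ → ℝ} (hh : ContDiff ℝ n h) :
    ContDiff ℝ n fun z : ℝ × ℝ => ∫ s in z.2..z.1, h (s, z.2) :=
  (contDiff_integral_diag n (hh.comp (contDiff_snd.prodMk contDiff_fst))).comp
    (contDiff_snd.prodMk contDiff_fst)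

theorem continuous_integral_swap {h : ℝ × ℝ → ℝ} (hh : Continuous h) :
    Continuous fun z : ℝ × ℝ => ∫ s in z.2..z.1, h (s, z.2) :=
  contDiff_zero.1 (contDiff_integral_swap 0 (contDiff_zero.2 hh))

theorem continuous_triangleIntegral {h : ℝ × ℝ → ℝ} (hh : Continuous h) :
    Continuous (triangleIntegral h) :=
  continuous_integral_diag (continuous_integral_swap hh)

theorem triangleIntegral_sub {h k : ℝ × ℝ → ℝ} (hh : Continuous h) (hk : Continuous k)
    (z : ℝ × ℝ) : triangleIntegral (fun p => h p - k p) z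
      = triangleIntegral h z - triangleIntegral k z := by
  have hx : ∀ {h : ℝ × ℝ → ℝ} (_ : Continuous h) (t : ℝ), Continuous fun s => h (s, t) :=
    fun hh t => hh.comp (by fun_prop : Continuous fun s : ℝ => (s, t))
  have hy : ∀ {h : ℝ × ℝ → ℝ} (_ : Continuous h),
      Continuous fun t => ∫ s in t..z.1, h (s, t) := fun hh =>
    (continuous_integral_swap hh).comp (by fun_prop : Continuous fun t : ℝ => (z.1, t))
  unfold triangleIntegral
  rw [← integral_sub ((hy hh).intervalIntegrable _ _) ((hy hk).intervalIntegrable _ _)]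
  refine integral_congr fun t _ => ?_
  exact integral_sub ((hx hh t).intervalIntegrable _ _) ((hx hk t).intervalIntegrable _ _)

/-- Each of the two integrations starts on the diagonal, where the weight is smallest, and gains a
factor 1/l. The triangle never leaves the square [-r, r]², so a bound on the square suffices. -/
theorem abs_triangleIntegral_le {l M r : ℝ} (hl : 0 < l) (hM : 0 ≤ M) {h : ℝ × ℝ → ℝ}
    (hh : ∀ s ∈ Set.Icc (-r) r, ∀ t ∈ Set.Icc (-r) r, |h (s, t)| ≤ M * Real.exp (l * |s - t|))
    {x y : ℝ} (hx : x ∈ Set.Icc (-r) r) (hy : y ∈ Set.Icc (-r) r) :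
    |triangleIntegral h (x, y)| ≤ M / l / l * Real.exp (l * |y - x|) := by
  have hsub : ∀ {a b : ℝ}, a ∈ Set.Icc (-r) r → b ∈ Set.Icc (-r) r →
      Set.uIcc a b ⊆ Set.Icc (-r) r := fun ha hb => Set.uIcc_subset_Icc ha hb
  refine abs_integral_le_exp hl (by positivity) fun t ht => ?_
  have ht' := hsub hx hy ht
  rw [abs_sub_comm t x]
  exact abs_integral_le_exp hl hM fun s hs => hh s (hsub ht' hx hs) t ht'

/-- Picard iteration for the integral equation of the Cauchy problem on the diagonal. -/
theorem exists_fixedPoint {u₀ : ℝ × ℝ → ℝ} (hu₀ : Continuous u₀) {H : ℝ × ℝ × ℝ → ℝ}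
    (hH : Continuous H)
    (hL : ∀ r : ℝ, ∃ L > 0, ∀ s ∈ Set.Icc (-r) r, ∀ t ∈ Set.Icc (-r) r, ∀ z z' : ℝ,
      |H (s, t, z) - H (s, t, z')| ≤ L * |z - z'|) :
    ∃ u : ℝ × ℝ → ℝ, Continuous u ∧
      ∀ z, u z = u₀ z + triangleIntegral (fun p => H (p.1, p.2, u p)) z := by
  have hcomp : ∀ {u : ℝ × ℝ → ℝ}, Continuous u → Continuous fun p : ℝ × ℝ => H (p.1, p.2, u p) :=
    fun hu => hH.comp (by fun_prop)
  let T : (ℝ × ℝ → ℝ) → ℝ × ℝ → ℝ := fun u z =>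
    u₀ z + triangleIntegral (fun p => H (p.1, p.2, u p)) z
  have hT : ∀ {u : ℝ × ℝ → ℝ}, Continuous u → Continuous (T u) := fun hu =>
    hu₀.add (continuous_triangleIntegral (hcomp hu))
  have contr : ∀ r : ℝ, ∃ l > 0, ∀ u v : ℝ × ℝ → ℝ, Continuous u → Continuous v → ∀ M ≥ 0,
      (∀ s ∈ Set.Icc (-r) r, ∀ t ∈ Set.Icc (-r) r,
        |u (s, t) - v (s, t)| ≤ M * Real.exp (l * |t - s|)) →
      ∀ s ∈ Set.Icc (-r) r, ∀ t ∈ Set.Icc (-r) r,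
        |T u (s, t) - T v (s, t)| ≤ M / 2 * Real.exp (l * |t - s|) := by
    intro r
    obtain ⟨L, hL0, hL⟩ := hL r
    -- Two integrations turn the Lipschitz bound L M into L M / l², and l = 2L + 1 gives L / l² ≤
    -- 1/2. The contraction factor is the same on all squares; only the weight depends on r.
    refine ⟨2 * L + 1, by positivity, fun u v hu hv M hM h s hs t ht => ?_⟩
    have h1 := abs_triangleIntegral_le (l := 2 * L + 1) (M := L * M) (r := r) (by positivity)
      (by positivity)
      (h := fun p => H (p.1, p.2, u p) - H (p.1, p.2, v p)) (by
        intro s hs t ht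
        refine (hL s hs t ht _ _).trans ?_
        rw [mul_assoc, abs_sub_comm s t]
        exact mul_le_mul_of_nonneg_left (h s hs t ht) hL0.le) hs ht
    rw [triangleIntegral_sub (hcomp hu) (hcomp hv)] at h1
    have e : T u (s, t) - T v (s, t) = triangleIntegral (fun p => H (p.1, p.2, u p)) (s, t) -
        triangleIntegral (fun p => H (p.1, p.2, v p)) (s, t) := by simp only [T]; ring
    rw [e]
    refine h1.trans (mul_le_mul_of_nonneg_right ?_ (Real.exp_pos _).le)
    rw [div_div, div_le_div_iff₀ (by positivity) two_pos]
    nlinarith [mul_nonneg hL0.le hM, mul_nonneg (mul_nonneg hL0.le hL0.le) hM]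
  let U : ℕ → ℝ × ℝ → ℝ := fun n => T^[n] u₀
  have hUs : ∀ n, U (n + 1) = T (U n) := fun n => Function.iterate_succ_apply' T n u₀
  have hUc : ∀ n, Continuous (U n) := by
    intro n
    induction n with
    | zero => exact hu₀
    | succ n ih => rw [hUs]; exact hT ih
  have step : ∀ r : ℝ, ∃ C ≥ 0, ∀ n, ∀ s ∈ Set.Icc (-r) r, ∀ t ∈ Set.Icc (-r) r,
      dist (U n (s, t)) (U (n + 1) (s, t)) ≤ C * (1 / 2) ^ n := by
    intro r
    obtain ⟨l, hl, hc⟩ := contr r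
    obtain ⟨C, hC⟩ := ((isCompact_Icc (a := -r) (b := r)).prod
      (isCompact_Icc (a := -r) (b := r))).exists_bound_of_continuousOn
      ((hUc 1).sub (hUc 0)).continuousOn
    have key : ∀ n, ∀ s ∈ Set.Icc (-r) r, ∀ t ∈ Set.Icc (-r) r,
        |U (n + 1) (s, t) - U n (s, t)| ≤ |C| * (1 / 2) ^ n * Real.exp (l * |t - s|) := by
      intro n
      induction n with
      | zero =>
        intro s hs t ht
        have h1 := hC (s, t) ⟨hs, ht⟩
        rw [Real.norm_eq_abs] at h1
        have h2 : 1 ≤ Real.exp (l * |t - s|) := Real.one_le_exp (by positivity)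
        have h3 := le_abs_self C
        rw [pow_zero, mul_one]
        calc |U (0 + 1) (s, t) - U 0 (s, t)| ≤ |C| * 1 := by rw [mul_one]; exact h1.trans h3
          _ ≤ _ := mul_le_mul_of_nonneg_left h2 (abs_nonneg _)
      | succ n ih =>
        have := hc (U (n + 1)) (U n) (hUc _) (hUc _) (|C| * (1 / 2) ^ n) (by positivity) ih
        intro s hs t ht
        have h := this s hs t ht
        rw [← hUs, ← hUs] at h
        rwa [show |C| * (1 / 2) ^ (n + 1) = |C| * (1 / 2) ^ n / 2 by ring]
    -- On the square |t - s| ≤ 2|r|, so the weight is bounded and the geometric decay holds in the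
    -- sup norm.
    refine ⟨|C| * Real.exp (l * (2 * |r|)), by positivity, fun n s hs t ht => ?_⟩
    rw [dist_comm, Real.dist_eq]
    refine (key n s hs t ht).trans ?_
    rw [mul_assoc, mul_assoc, mul_comm (Real.exp _)]
    gcongr
    rw [abs_le]
    have := le_abs_self r
    constructor <;> linarith [hs.1, hs.2, ht.1, ht.2]
  have hmem : ∀ z : ℝ × ℝ, z.1 ∈ Set.Icc (-‖z‖) ‖z‖ ∧ z.2 ∈ Set.Icc (-‖z‖) ‖z‖ := fun z =>
    ⟨abs_le.1 (norm_fst_le z), abs_le.1 (norm_snd_le z)⟩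
  have hlim : ∀ z, ∃ a, Filter.Tendsto (fun n => U n z) Filter.atTop (nhds a) := by
    intro z
    obtain ⟨C, -, hC⟩ := step ‖z‖
    exact cauchySeq_tendsto_of_complete (cauchySeq_of_le_geometric (1 / 2) C (by norm_num)
      fun n => hC n z.1 (hmem z).1 z.2 (hmem z).2)
  choose u hu using hlim
  have rate : ∀ r : ℝ, ∃ C ≥ 0, ∀ n, ∀ s ∈ Set.Icc (-r) r, ∀ t ∈ Set.Icc (-r) r,
      |U n (s, t) - u (s, t)| ≤ C * (1 / 2) ^ n := by
    intro r
    obtain ⟨C, hC0, hC⟩ := step r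
    refine ⟨2 * C, by positivity, fun n s hs t ht => ?_⟩
    have := dist_le_of_le_geometric_of_tendsto (1 / 2) C (by norm_num)
      (fun n => hC n s hs t ht) (hu (s, t)) n
    rw [Real.dist_eq] at this
    refine this.trans (le_of_eq ?_)
    ring
  have hgeom : ∀ C : ℝ, Filter.Tendsto (fun n : ℕ => C * (1 / 2 : ℝ) ^ n) Filter.atTop
      (nhds 0) := fun C => by
    simpa using (tendsto_pow_atTop_nhds_zero_of_lt_one (r := (1 / 2 : ℝ)) (by norm_num)
      (by norm_num)).const_mul C
  have huc : Continuous u := by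
    rw [continuous_iff_continuousAt]
    intro z
    obtain ⟨C, hC0, hC⟩ := rate (‖z‖ + 1)
    -- Convergence is uniform on squares, hence on the unit ball around z, which lies in the square
    -- of half-side ‖z‖ + 1.
    have hunif : TendstoUniformlyOn U u Filter.atTop (Metric.ball z 1) := by
      rw [Metric.tendstoUniformlyOn_iff]
      intro e he
      filter_upwards [(hgeom C).eventually (gt_mem_nhds he)] with n hn w hw
      have hw' : ‖w‖ ≤ ‖z‖ + 1 := by
        have := norm_le_norm_add_norm_sub z w
        rw [Metric.mem_ball, dist_eq_norm, ← norm_neg, neg_sub] at hw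
        linarith
      have h1 := (hmem w).1
      have h2 := (hmem w).2
      rw [dist_comm, Real.dist_eq]
      exact (hC n w.1 ⟨by linarith [h1.1], h1.2.trans hw'⟩ w.2
        ⟨by linarith [h2.1], h2.2.trans hw'⟩).trans_lt hn
    exact (hunif.continuousOn (Filter.Eventually.of_forall fun n =>
      (hUc n).continuousOn).frequently).continuousAt (Metric.ball_mem_nhds z one_pos)
  refine ⟨u, huc, fun z => ?_⟩
  have h1 : Filter.Tendsto (fun n => U (n + 1) z) Filter.atTop (nhds (T u z)) := by
    obtain ⟨l, hl, hc⟩ := contr ‖z‖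
    obtain ⟨C, hC0, hC⟩ := rate ‖z‖
    rw [tendsto_iff_dist_tendsto_zero]
    refine squeeze_zero (fun _ => dist_nonneg) (fun n => ?_)
      (hgeom (C / 2 * Real.exp (l * |z.2 - z.1|)))
    have := hc (U n) u (hUc n) huc (C * (1 / 2) ^ n) (by positivity) (fun s hs t ht =>
      (hC n s hs t ht).trans (le_mul_of_one_le_right (by positivity)
        (Real.one_le_exp (by positivity)))) z.1 (hmem z).1 z.2 (hmem z).2
    rw [hUs, Real.dist_eq]
    refine this.trans (le_of_eq ?_)
    ring
  exact tendsto_nhds_unique ((hu z).comp (Filter.tendsto_add_atTop_nat 1)) h1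

/-- The moving lower end contributes nothing, since the inner integral there runs from x to x. -/
theorem hasDerivAt_triangleIntegral_fst {h : ℝ × ℝ → ℝ} (hh : Continuous h) (x y : ℝ) :
    HasDerivAt (fun s => triangleIntegral h (s, y)) (∫ t in x..y, h (x, t)) x := by
  have := hasDerivAt_integral_diag (continuous_integral_swap hh) hh
    (fun x t => integral_hasDerivAt_right
      ((hh.comp (by fun_prop : Continuous fun s : ℝ => (s, t))).intervalIntegrable _ _)
      (hh.comp (by fun_prop : Continuous fun s : ℝ => (s, t))
        ).aestronglyMeasurable.stronglyMeasurableAtFilter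
      (hh.comp (by fun_prop : Continuous fun s : ℝ => (s, t))).continuousAt) y x
  refine this.congr_deriv ?_
  simp

theorem hasDerivAt_triangleIntegral_snd {h : ℝ × ℝ → ℝ} (hh : Continuous h) (x y : ℝ) :
    HasDerivAt (fun t => triangleIntegral h (x, t)) (∫ s in y..x, h (s, y)) y := by
  have hc : Continuous fun t => ∫ s in t..x, h (s, t) :=
    (continuous_integral_swap hh).comp (by fun_prop : Continuous fun t : ℝ => (x, t))
  exact integral_hasDerivAt_right (hc.intervalIntegrable _ _)
    hc.aestronglyMeasurable.stronglyMeasurableAtFilter hc.continuousAt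

/-- The Cauchy problem with data on the diagonal. -/
theorem exists_solution_diagonal {H : ℝ × ℝ × ℝ → ℝ} (hH : ContDiff ℝ ∞ H)
    (hL : ∀ r : ℝ, ∃ L > 0, ∀ s ∈ Set.Icc (-r) r, ∀ t ∈ Set.Icc (-r) r, ∀ z z' : ℝ,
      |H (s, t, z) - H (s, t, z')| ≤ L * |z - z'|)
    {φ χ : ℝ → ℝ} (hφ : ContDiff ℝ ∞ φ) (hχ : ContDiff ℝ ∞ χ) :
    ∃ u q : ℝ × ℝ → ℝ, ContDiff ℝ ∞ u ∧
      (∀ x y, HasDerivAt (fun t => u (x, t)) (q (x, y)) y) ∧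
      (∀ x y, HasDerivAt (fun s => q (s, y)) (H (x, y, u (x, y))) x) ∧
      (∀ x, u (x, x) = φ x) ∧ ∀ x, q (x, x) = χ x := by
  have hI : ∀ a b, IntervalIntegrable χ volume a b := fun a b =>
    hχ.continuous.intervalIntegrable a b
  have hIr : ∀ x y, HasDerivAt (fun t => ∫ s in x..t, χ s) (χ y) y := fun x y =>
    integral_hasDerivAt_right (hI _ _)
      hχ.continuous.aestronglyMeasurable.stronglyMeasurableAtFilter hχ.continuous.continuousAt
  have hIl : ∀ x y, HasDerivAt (fun t => ∫ s in t..y, χ s) (-χ x) x := fun x y =>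
    integral_hasDerivAt_left (hI _ _)
      hχ.continuous.aestronglyMeasurable.stronglyMeasurableAtFilter hχ.continuous.continuousAt
  have hu₀ : Continuous fun z : ℝ × ℝ => φ z.1 + ∫ s in z.1..z.2, χ s :=
    (hφ.continuous.comp continuous_fst).add
      (continuous_integral_diag (h := fun z => χ z.2) (hχ.continuous.comp continuous_snd))
  obtain ⟨u, huc, hu⟩ := exists_fixedPoint hu₀ hH.continuous hL
  have hhc : Continuous fun p : ℝ × ℝ => H (p.1, p.2, u p) := hH.continuous.comp (by fun_prop)
  have hux : ∀ x y, HasDerivAt (fun s => u (s, y))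
      (deriv φ x + -χ x + ∫ t in x..y, H (x, t, u (x, t))) x := by
    intro x y
    rw [show (fun s => u (s, y)) = _ from funext fun s => hu (s, y)]
    exact (((hφ.differentiable (by simp)) x).hasDerivAt.add (hIl x y)).add
      (hasDerivAt_triangleIntegral_fst hhc x y)
  have huy : ∀ x y, HasDerivAt (fun t => u (x, t))
      (χ y + ∫ s in y..x, H (s, y, u (s, y))) y := by
    intro x y
    rw [show (fun t => u (x, t)) = _ from funext fun t => hu (x, t)]
    exact ((hIr x y).const_add (φ x)).add (hasDerivAt_triangleIntegral_snd hhc x y)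
  -- Bootstrap: both partial derivatives are integrals of H(·, ·, u), so they inherit the class of
  -- u, and u gains one order.
  have hsmooth : ∀ n : ℕ, ContDiff ℝ n u := by
    intro n
    induction n with
    | zero => exact contDiff_zero.2 huc
    | succ n ih =>
      have hhn : ContDiff ℝ n fun p : ℝ × ℝ => H (p.1, p.2, u p) :=
        (hH.of_le (by exact_mod_cast le_top)).comp
          (contDiff_fst.prodMk (contDiff_snd.prodMk ih))
      have hφ' : ContDiff ℝ n (deriv φ) :=
        (contDiff_infty_iff_deriv.1 hφ).2.of_le (by exact_mod_cast le_top)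
      have hχn : ContDiff ℝ n χ := hχ.of_le (by exact_mod_cast le_top)
      exact contDiff_succ_of_partial
        (p := fun z => deriv φ z.1 + -χ z.1 + ∫ t in z.1..z.2, H (z.1, t, u (z.1, t)))
        (q := fun z => χ z.2 + ∫ s in z.2..z.1, H (s, z.2, u (s, z.2)))
        (((hφ'.comp contDiff_fst).add (hχn.comp contDiff_fst).neg).add
          (contDiff_integral_diag n hhn))
        ((hχn.comp contDiff_snd).add (contDiff_integral_swap n hhn)) hux huy
  refine ⟨u, fun z => χ z.2 + ∫ s in z.2..z.1, H (s, z.2, u (s, z.2)),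
    contDiff_infty.2 hsmooth, huy, fun x y => ?_, fun x => ?_, fun x => ?_⟩
  · have hc : Continuous fun s => H (s, y, u (s, y)) :=
      hhc.comp (by fun_prop : Continuous fun s : ℝ => (s, y))
    exact (integral_hasDerivAt_right (hc.intervalIntegrable _ _)
      hc.aestronglyMeasurable.stronglyMeasurableAtFilter hc.continuousAt).const_add (χ y)
  · rw [hu]; simp [triangleIntegral]
  · simp

/-- Injectivity is Rolle's theorem, and a nonzero strict derivative makes the map open, so the
bijection is a homeomorphism with smooth inverse. -/
theorem exists_smooth_inverse {f : ℝ → ℝ} (hf : ContDiff ℝ ∞ f) (hf' : ∀ x, deriv f x ≠ 0)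
    (hs : Function.Surjective f) :
    ∃ g : ℝ → ℝ, ContDiff ℝ ∞ g ∧ (∀ x, g (f x) = x) ∧ ∀ y, f (g y) = y := by
  have hd : ∀ x, HasDerivAt f (deriv f x) x := fun x =>
    (hf.differentiable (by simp) x).hasDerivAt
  have hinj : Function.Injective f := by
    have key : ∀ a b, a < b → f a ≠ f b := by
      intro a b hab he
      obtain ⟨c, -, hc⟩ := exists_deriv_eq_zero hab hf.continuous.continuousOn he
      exact hf' c hc
    intro a b he
    by_contra hne
    rcases lt_or_gt_of_ne hne with h | h
    · exact key a b h he
    · exact key b a h he.symm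
  have hopen : IsOpenMap f := isOpenMap_of_hasStrictDerivAt (f' := deriv f)
    (fun x => (hf.contDiffAt.hasStrictDerivAt (by simp))) hf'
  let e : ℝ ≃ₜ ℝ := (Equiv.ofBijective f ⟨hinj, hs⟩).toHomeomorphOfContinuousOpen
    hf.continuous hopen
  exact ⟨e.symm, e.contDiff_symm_deriv hf' hd hf, fun x => e.symm_apply_apply x,
    fun y => e.apply_symm_apply y⟩

/-- Bounds on `∂F/∂z` over a compact set give a Lipschitz constant in `z`. -/
theorem exists_lipschitz (F : Smooth (ℝ × ℝ × ℝ))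
    (hF : ∀ K : Set (ℝ × ℝ), IsCompact K →
      ∃ C : ℝ, ∀ p ∈ K, ∀ z : ℝ, |deriv (fun s => F.1 (p.1, p.2, s)) z| ≤ C)
    {K : Set (ℝ × ℝ)} (hK : IsCompact K) :
    ∃ L > 0, ∀ p ∈ K, ∀ z z' : ℝ,
      |F.1 (p.1, p.2, z) - F.1 (p.1, p.2, z')| ≤ L * |z - z'| := by
  obtain ⟨C, hC⟩ := hF K hK
  refine ⟨|C| + 1, by positivity, fun p hp z z' => ?_⟩
  have hd : Differentiable ℝ fun s => F.1 (p.1, p.2, s) :=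
    ((contDiff_coe F).differentiable (by simp)).comp
      ((differentiable_const _).prodMk ((differentiable_const _).prodMk differentiable_id))
  exact Convex.norm_image_sub_le_of_norm_deriv_le (s := Set.univ) (fun x _ => hd x)
    (fun x _ => (hC p hp x).trans (by linarith [le_abs_self C])) convex_univ
    (Set.mem_univ _) (Set.mem_univ _)

theorem exists_isSolution (F : Smooth (ℝ × ℝ × ℝ))
    (hF : ∀ K : Set (ℝ × ℝ), IsCompact K →
      ∃ C : ℝ, ∀ p ∈ K, ∀ z : ℝ, |deriv (fun s => F.1 (p.1, p.2, s)) z| ≤ C)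
    (φ ψ f : Smooth ℝ) (hf : IsNonCharacteristic f) : ∃ u, IsSolution F φ ψ f u := by
  have hfs := contDiff_coe f
  have hf' : ContDiff ℝ ∞ (deriv (f : ℝ → ℝ)) := (contDiff_infty_iff_deriv.1 hfs).2
  obtain ⟨g, hg, hgf, hfg⟩ := exists_smooth_inverse hfs hf.1 hf.2
  have hfd : ∀ x, HasDerivAt (f : ℝ → ℝ) (deriv (f : ℝ → ℝ) x) x := fun x =>
    (hfs.differentiable (by simp) x).hasDerivAt
  have hgd : ∀ y, HasDerivAt g (deriv g y) y := fun y => (hg.differentiable (by simp) y).hasDerivAt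
  have hgd' : ∀ y, deriv (f : ℝ → ℝ) (g y) * deriv g y = 1 := fun y => by
    have h := (hfd (g y)).comp y (hgd y)
    rw [show (f : ℝ → ℝ) ∘ g = id from funext hfg] at h
    exact h.unique (hasDerivAt_id y)
  -- In the variable t = g(y) both the equation and the datum for ∂u/∂t acquire the factor f'(t),
  -- which g'(y) cancels on the way back.
  obtain ⟨u, q, hu, huy, hqx, hud, hqd⟩ := exists_solution_diagonal
    (H := fun p => deriv (f : ℝ → ℝ) p.2.1 * F.1 (p.1, f.1 p.2.1, p.2.2))
    ((hf'.comp (contDiff_fst.comp contDiff_snd)).mul ((contDiff_coe F).comp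
      (contDiff_fst.prodMk ((hfs.comp (contDiff_fst.comp contDiff_snd)).prodMk
        (contDiff_snd.comp contDiff_snd)))))
    (by
      intro r
      obtain ⟨L, hL0, hL⟩ := exists_lipschitz F hF
        ((isCompact_Icc (a := -r) (b := r)).prod
          ((isCompact_Icc (a := -r) (b := r)).image hfs.continuous))
      obtain ⟨C, hC⟩ := (isCompact_Icc (a := -r) (b := r)).exists_bound_of_continuousOn
        hf'.continuous.continuousOn
      refine ⟨(|C| + 1) * L, by positivity, fun s hs t ht z z' => ?_⟩
      simp only
      rw [← mul_sub, abs_mul, mul_assoc]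
      refine mul_le_mul ((hC t ht).trans (by linarith [le_abs_self C]))
        (hL (s, f.1 t) ⟨hs, t, ht, rfl⟩ z z') (abs_nonneg _) (by positivity))
    (contDiff_coe φ) (hf'.mul (contDiff_coe ψ))
  have hy : ∀ x y, HasDerivAt (fun t => u (x, g t)) (q (x, g y) * deriv g y) y := fun x y =>
    (huy x (g y)).comp y (hgd y)
  refine ⟨⟨fun p => u (p.1, g p.2), hu.comp (contDiff_fst.prodMk (hg.comp contDiff_snd))⟩,
    fun x y => ?_, fun x => ?_, fun x => ?_⟩
  · have e : ∀ s, dy (fun p => u (p.1, g p.2)) s y = q (s, g y) * deriv g y := fun s =>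
      (hy s y).deriv
    change deriv (fun s => dy (fun p => u (p.1, g p.2)) s y) x = F.1 (x, y, u (x, g y))
    simp_rw [e]
    rw [((hqx x (g y)).mul_const (deriv g y)).deriv]
    simp only [hfg]
    rw [mul_right_comm, hgd', one_mul]
  · change u (x, g (f.1 x)) = φ.1 x
    rw [hgf, hud]
  · change deriv (fun t => u (x, g t)) (f.1 x) = ψ.1 x
    rw [(hy x (f.1 x)).deriv, hgf, hqd]
    have := hgd' (f.1 x)
    rw [hgf] at this
    rw [mul_right_comm, this, one_mul]

end Existence

/-! ### Calculus of families that are O(ε^q) up to order k on compact sets -/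

section Growth

/-- The filter `ε → 0` on `(0,1]`. -/
def nearZero : Filter Idx := Filter.comap (fun ε : Idx => (ε : ℝ)) (nhds 0)

theorem eventually_nearZero {P : Idx → Prop} :
    (∀ᶠ ε in nearZero, P ε) ↔ ∃ μ > (0 : ℝ), ∀ ε : Idx, (ε : ℝ) ≤ μ → P ε := by
  unfold nearZero
  rw [Filter.eventually_comap, Metric.eventually_nhds_iff]
  constructor
  · rintro ⟨r, hr, h⟩
    refine ⟨r / 2, by positivity, fun ε hε => h ?_ ε rfl⟩
    rw [Real.dist_eq, sub_zero, abs_of_pos ε.2.1]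
    linarith
  · rintro ⟨μ, hμ, h⟩
    refine ⟨μ, hμ, fun {y} hy ε hε => h ε ?_⟩
    rw [Real.dist_eq, sub_zero] at hy
    rw [hε]
    exact (le_abs_self _).trans hy.le

instance : nearZero.NeBot := by
  rw [Filter.neBot_iff]
  intro h
  have h0 : ∀ᶠ _ε in nearZero, False := by rw [h]; exact Filter.eventually_bot
  obtain ⟨μ, hμ, h1⟩ := eventually_nearZero.1 h0
  exact h1 ⟨min μ 1, lt_min hμ one_pos, min_le_right _ _⟩ (min_le_left _ _)

theorem eventually_mul_lt (D : ℝ) {c : ℝ} (hc : 0 < c) :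
    ∀ᶠ ε : Idx in nearZero, D * (ε : ℝ) < c := by
  have : Filter.Tendsto (fun ε : Idx => D * (ε : ℝ)) nearZero (nhds (D * 0)) :=
    Filter.Tendsto.const_mul D Filter.tendsto_comap
  rw [mul_zero] at this
  exact this.eventually (gt_mem_nhds hc)

variable {E F G : Type} [NormedAddCommGroup E] [NormedSpace ℝ E] [NormedAddCommGroup F]
  [NormedSpace ℝ F] [NormedAddCommGroup G] [NormedSpace ℝ G]

/-- Families of smooth maps whose derivatives up to order `k` are `O(ε^q)` on compact sets. -/
structure BigO (q k : ℕ) (u : Idx → E → F) : Prop where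
  smooth : ∀ ε, ContDiff ℝ ∞ (u ε)
  bound : ∀ K : Set E, IsCompact K → ∃ D ≥ 0, ∀ᶠ ε in nearZero, ∀ x ∈ K, ∀ l ≤ k,
    ‖iteratedFDeriv ℝ l (u ε) x‖ ≤ D * (ε : ℝ) ^ q

theorem natCast_le_infty (l : ℕ) : ((l : ℕ∞) : WithTop ℕ∞) ≤ ∞ := by exact_mod_cast le_top

theorem BigO.mono {q k q' k' : ℕ} {u : Idx → E → F} (hu : BigO q k u) (hq : q' ≤ q)
    (hk : k' ≤ k) : BigO q' k' u := by
  refine ⟨hu.smooth, fun K hK => ?_⟩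
  obtain ⟨D, hD, h⟩ := hu.bound K hK
  refine ⟨D, hD, h.mono fun ε h x hx l hl => (h x hx l (hl.trans hk)).trans ?_⟩
  exact mul_le_mul_of_nonneg_left (pow_le_pow_of_le_one ε.2.1.le ε.2.2 hq) hD

theorem BigO.bound_zero {q k : ℕ} {u : Idx → E → F} (hu : BigO q k u) {K : Set E}
    (hK : IsCompact K) :
    ∃ D ≥ 0, ∀ᶠ ε in nearZero, ∀ x ∈ K, ‖u ε x‖ ≤ D * (ε : ℝ) ^ q := by
  obtain ⟨D, hD, h⟩ := hu.bound K hK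
  refine ⟨D, hD, h.mono fun ε h x hx => ?_⟩
  simpa using h x hx 0 (Nat.zero_le _)

theorem bigO_zero_order {q : ℕ} {u : Idx → E → F} (hs : ∀ ε, ContDiff ℝ ∞ (u ε))
    (h : ∀ K : Set E, IsCompact K → ∃ D ≥ 0, ∀ᶠ ε in nearZero, ∀ x ∈ K,
      ‖u ε x‖ ≤ D * (ε : ℝ) ^ q) : BigO q 0 u := by
  refine ⟨hs, fun K hK => ?_⟩
  obtain ⟨D, hD, h⟩ := h K hK
  refine ⟨D, hD, h.mono fun ε h x hx l hl => ?_⟩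
  obtain rfl := Nat.le_zero.1 hl
  simpa using h x hx

theorem BigO.add {q k : ℕ} {u v : Idx → E → F} (hu : BigO q k u) (hv : BigO q k v) :
    BigO q k fun ε x => u ε x + v ε x := by
  refine ⟨fun ε => (hu.smooth ε).add (hv.smooth ε), fun K hK => ?_⟩
  obtain ⟨D, hD, h⟩ := hu.bound K hK
  obtain ⟨D', hD', h'⟩ := hv.bound K hK
  refine ⟨D + D', by positivity, ?_⟩
  filter_upwards [h, h'] with ε h h' x hx l hl
  have e : (fun x => u ε x + v ε x) = u ε + v ε := rfl
  rw [e, iteratedFDeriv_add_apply ((hu.smooth ε).contDiffAt.of_le (natCast_le_infty l))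
    ((hv.smooth ε).contDiffAt.of_le (natCast_le_infty l)), add_mul]
  exact (norm_add_le _ _).trans (add_le_add (h x hx l hl) (h' x hx l hl))

theorem BigO.clm_comp {q k : ℕ} {u : Idx → E → F} (hu : BigO q k u) (L : F →L[ℝ] G) :
    BigO q k fun ε x => L (u ε x) := by
  refine ⟨fun ε => L.contDiff.comp (hu.smooth ε), fun K hK => ?_⟩
  obtain ⟨D, hD, h⟩ := hu.bound K hK
  refine ⟨‖L‖ * D, by positivity, h.mono fun ε h x hx l hl => ?_⟩
  refine (L.norm_iteratedFDeriv_comp_left (hu.smooth ε).contDiffAt (natCast_le_infty l)).trans ?_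
  rw [mul_assoc]
  exact mul_le_mul_of_nonneg_left (h x hx l hl) (norm_nonneg _)

theorem BigO.neg {q k : ℕ} {u : Idx → E → F} (hu : BigO q k u) :
    BigO q k fun ε x => -u ε x := by
  simpa using hu.clm_comp (-ContinuousLinearMap.id ℝ F)

theorem BigO.sub {q k : ℕ} {u v : Idx → E → F} (hu : BigO q k u) (hv : BigO q k v) :
    BigO q k fun ε x => u ε x - v ε x := by
  simpa only [sub_eq_add_neg] using hu.add hv.neg

theorem BigO.prodMk {q k : ℕ} {u : Idx → E → F} {v : Idx → E → G} (hu : BigO q k u)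
    (hv : BigO q k v) : BigO q k fun ε x => (u ε x, v ε x) := by
  simpa using (hu.clm_comp (ContinuousLinearMap.inl ℝ F G)).add
    (hv.clm_comp (ContinuousLinearMap.inr ℝ F G))

theorem bigO_zero (q k : ℕ) : BigO q k fun (_ : Idx) (_ : E) => (0 : F) := by
  refine ⟨fun _ => contDiff_const, fun K _ => ⟨0, le_rfl, Filter.Eventually.of_forall
    fun ε x _ l _ => ?_⟩⟩
  have : iteratedFDeriv ℝ l (fun _ : E => (0 : F)) x = 0 := by
    rw [iteratedFDeriv_fun_zero]; rfl
  rw [this]; simp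

theorem bigO_sum {ι : Type} (s : Finset ι) {q k : ℕ} {u : ι → Idx → E → F}
    (hu : ∀ i, BigO q k (u i)) : BigO q k fun ε x => ∑ i ∈ s, u i ε x := by
  classical
  induction s using Finset.induction_on with
  | empty => simpa using bigO_zero q k
  | insert i s hi ih => simpa only [Finset.sum_insert hi] using (hu i).add ih

theorem bigO_const (k : ℕ) {u : E → F} (hu : ContDiff ℝ ∞ u) : BigO 0 k fun _ : Idx => u := by
  refine ⟨fun _ => hu, fun K hK => ?_⟩
  induction k with
  | zero =>
    obtain ⟨C, hC⟩ := hK.exists_bound_of_continuousOn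
      (hu.continuous_iteratedFDeriv (natCast_le_infty 0)).continuousOn
    refine ⟨|C|, abs_nonneg _, Filter.Eventually.of_forall fun ε x hx l hl => ?_⟩
    obtain rfl := Nat.le_zero.1 hl
    rw [pow_zero, mul_one]
    exact (hC x hx).trans (le_abs_self _)
  | succ k ih =>
    obtain ⟨D, hD, h⟩ := ih
    obtain ⟨C, hC⟩ := hK.exists_bound_of_continuousOn
      (hu.continuous_iteratedFDeriv (natCast_le_infty (k + 1))).continuousOn
    refine ⟨max D C, hD.trans (le_max_left _ _), h.mono fun ε h x hx l hl => ?_⟩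
    rw [pow_zero, mul_one]
    rcases Nat.lt_or_ge k l with hkl | hkl
    · obtain rfl : l = k + 1 := by omega
      exact (hC x hx).trans (le_max_right _ _)
    · have := h x hx l hkl
      rw [pow_zero, mul_one] at this
      exact this.trans (le_max_left _ _)

theorem BigO.mul {q k : ℕ} {u v : Idx → E → ℝ} (hu : BigO 0 k u) (hv : BigO q k v) :
    BigO q k fun ε x => u ε x * v ε x := by
  refine ⟨fun ε => (hu.smooth ε).mul (hv.smooth ε), fun K hK => ?_⟩
  obtain ⟨D, hD, h⟩ := hu.bound K hK
  obtain ⟨D', hD', h'⟩ := hv.bound K hK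
  refine ⟨2 ^ k * (D * D'), by positivity, ?_⟩
  filter_upwards [h, h'] with ε h h' x hx l hl
  have key := norm_iteratedFDeriv_mul_le_of_le ⟨u ε, hu.smooth ε⟩ ⟨v ε, hv.smooth ε⟩ l x
    (fun i hi => h x hx i (hi.trans hl)) (fun i hi => h' x hx i (hi.trans hl))
  have e0 : (0 : ℝ) < ε := ε.2.1
  have hp : (2 : ℝ) ^ l ≤ 2 ^ k := pow_le_pow_right₀ one_le_two hl
  calc _ ≤ _ := key
    _ = 2 ^ l * (D * D' * (ε : ℝ) ^ q) := by ring
    _ ≤ 2 ^ k * (D * D' * (ε : ℝ) ^ q) := mul_le_mul_of_nonneg_right hp (by positivity)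
    _ = _ := by ring

/-- The inner family is O(1), so it maps a compact set into a ball independent of ε, on which the
outer bound applies. -/
theorem BigO.comp [ProperSpace F] {q k : ℕ} {u : Idx → F → G} {c : Idx → E → F}
    (hu : BigO q k u) (hc : BigO 0 k c) : BigO q k fun ε x => u ε (c ε x) := by
  refine ⟨fun ε => (hu.smooth ε).comp (hc.smooth ε), fun K hK => ?_⟩
  obtain ⟨D, hD, h⟩ := hc.bound K hK
  obtain ⟨D', hD', h'⟩ := hu.bound (Metric.closedBall 0 D) (isCompact_closedBall _ _)
  refine ⟨k.factorial * D' * (D + 1) ^ k, by positivity, ?_⟩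
  filter_upwards [h, h'] with ε h h' x hx l hl
  have e0 : (0 : ℝ) < ε := ε.2.1
  have hcx : c ε x ∈ Metric.closedBall (0 : F) D := by
    have := h x hx 0 (Nat.zero_le _)
    simpa using this
  -- The composition bound asks for the i-th inner derivative to be at most a power D^i; the base D
  -- + 1 ≥ 1 ensures D ≤ (D + 1)^i for i ≥ 1.
  have key := norm_iteratedFDeriv_comp_le (hu.smooth ε) (hc.smooth ε) (natCast_le_infty l) x
    (C := D' * (ε : ℝ) ^ q) (D := D + 1) (fun i hi => h' _ hcx i (hi.trans hl)) (by
      intro i hi hil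
      have := h x hx i (hil.trans hl)
      rw [pow_zero, mul_one] at this
      refine this.trans ((by linarith : D ≤ D + 1).trans ?_)
      exact le_self_pow₀ (by linarith) (by omega))
  calc _ ≤ _ := key
    _ = (l.factorial * (D + 1) ^ l : ℝ) * (D' * (ε : ℝ) ^ q) := by ring
    _ ≤ (k.factorial * (D + 1) ^ k : ℝ) * (D' * (ε : ℝ) ^ q) := by
        refine mul_le_mul_of_nonneg_right ?_ (by positivity)
        refine mul_le_mul ?_ (pow_le_pow_right₀ (by linarith) hl) (by positivity) (by positivity)
        exact_mod_cast Nat.factorial_le hl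
    _ = _ := by ring

theorem BigO.fderiv_apply {q k : ℕ} {u : Idx → E → F} (hu : BigO q (k + 1) u) (e : E) :
    BigO q k fun ε x => fderiv ℝ (u ε) x e := by
  have h1 : BigO q k fun ε => fderiv ℝ (u ε) := by
    refine ⟨fun ε => (hu.smooth ε).fderiv_right (m := ∞) (by simp), fun K hK => ?_⟩
    obtain ⟨D, hD, h⟩ := hu.bound K hK
    refine ⟨D, hD, h.mono fun ε h x hx l hl => ?_⟩
    rw [norm_iteratedFDeriv_fderiv]
    exact h x hx (l + 1) (by omega)
  exact h1.clm_comp (ContinuousLinearMap.apply ℝ F e)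

/-- In a finite basis the full derivative is a sum of directional derivatives composed with fixed
linear maps, so directional bounds suffice. This is what makes inductions on the order run through
scalar partial derivatives. -/
theorem BigO.succ [FiniteDimensional ℝ E] {q k : ℕ} {u : Idx → E → F} (hu : BigO q 0 u)
    (hd : ∀ e, BigO q k fun ε x => fderiv ℝ (u ε) x e) : BigO q (k + 1) u := by
  have h1 : BigO q k fun ε => fderiv ℝ (u ε) := by
    let b := Module.finBasis ℝ E
    let c : ∀ i, E →L[ℝ] ℝ := fun i => LinearMap.toContinuousLinearMap (b.coord i)
    have h2 := bigO_sum Finset.univ fun i =>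
      (hd (b i)).clm_comp (ContinuousLinearMap.smulRightL ℝ E F (c i))
    have e : (fun ε => fderiv ℝ (u ε)) = fun ε x =>
        ∑ i, ContinuousLinearMap.smulRightL ℝ E F (c i) (fderiv ℝ (u ε) x (b i)) := by
      funext ε x
      ext v
      conv_lhs => rw [← b.sum_repr v, map_sum]
      simp [c]
    rw [e]
    exact h2
  refine ⟨hu.smooth, fun K hK => ?_⟩
  obtain ⟨D, hD, h⟩ := hu.bound K hK
  obtain ⟨D', hD', h'⟩ := h1.bound K hK
  refine ⟨D + D', by positivity, ?_⟩
  filter_upwards [h, h'] with ε h h' x hx l hl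
  have e0 : (0 : ℝ) < ε := ε.2.1
  rw [add_mul]
  rcases l with _ | l
  · exact (h x hx 0 le_rfl).trans (le_add_of_nonneg_right (by positivity))
  · rw [← norm_iteratedFDeriv_fderiv]
    exact (h' x hx l (by omega)).trans (le_add_of_nonneg_left (by positivity))

theorem BigO.deriv {q k : ℕ} {u : Idx → ℝ → ℝ} (hu : BigO q (k + 1) u) :
    BigO q k fun ε => deriv (u ε) := by
  have := hu.fderiv_apply 1
  simpa only [fderiv_apply_one_eq_deriv] using this

theorem BigO.const_mul {q k : ℕ} {u : Idx → E → ℝ} (hu : BigO q k u) (a : ℝ) :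
    BigO q k fun ε x => a * u ε x := by
  simpa using hu.clm_comp (a • ContinuousLinearMap.id ℝ ℝ)

theorem BigO.succ_real {q k : ℕ} {u : Idx → ℝ → ℝ} (hu : BigO q 0 u)
    (hd : BigO q k fun ε => _root_.deriv (u ε)) : BigO q (k + 1) u := by
  refine hu.succ fun e => ?_
  simpa only [fderiv_eq_smul_deriv, smul_eq_mul] using hd.const_mul e

theorem BigO.succ_prod {q k : ℕ} {u : Idx → ℝ × ℝ → ℝ} (hu : BigO q 0 u)
    (hx : BigO q k fun ε p => fderiv ℝ (u ε) p (1, 0))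
    (hy : BigO q k fun ε p => fderiv ℝ (u ε) p (0, 1)) : BigO q (k + 1) u := by
  refine hu.succ fun e => ?_
  have := (hx.const_mul e.1).add (hy.const_mul e.2)
  convert this using 3 with ε p
  conv_lhs => rw [show e = e.1 • (1, 0) + e.2 • (0, 1) by ext <;> simp]
  rw [map_add, map_smul, map_smul, smul_eq_mul, smul_eq_mul]

/-- Substituting a small family in a smooth function vanishing for `z = 0`. -/
theorem BigO.substitute [FiniteDimensional ℝ E] {q : ℕ} (k : ℕ) :
    ∀ {Φ : E × ℝ → ℝ} {w : Idx → E → ℝ}, ContDiff ℝ ∞ Φ → (∀ p, Φ (p, 0) = 0) → BigO q k w →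
      BigO q k fun ε p => Φ (p, w ε p) := by
  have : ProperSpace E := FiniteDimensional.proper ℝ E
  have hid : ∀ k, BigO 0 k fun (_ : Idx) (p : E) => p := fun k => bigO_const k contDiff_id
  induction k with
  | zero =>
    intro Φ w hΦ h0 hw
    refine bigO_zero_order (fun ε => hΦ.comp (contDiff_id.prodMk (hw.smooth ε))) fun K hK => ?_
    obtain ⟨D, hD, h⟩ := hw.bound_zero hK
    have hΦ' : ContDiff ℝ ∞ fun z => fderiv ℝ Φ z (0, 1) :=
      (hΦ.fderiv_right (m := ∞) (by simp)).clm_apply contDiff_const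
    obtain ⟨C, hC⟩ := (hK.prod (isCompact_closedBall (0 : ℝ) D)).exists_bound_of_continuousOn
      hΦ'.continuous.continuousOn
    refine ⟨|C| * D, by positivity, h.mono fun ε h p hp => ?_⟩
    have e0 : (0 : ℝ) < ε := ε.2.1
    -- Since ε ≤ 1, the values of w stay in a ball independent of ε, where ∂Φ/∂z has a fixed bound.
    have hwD : w ε p ∈ Metric.closedBall (0 : ℝ) D := by
      rw [mem_closedBall_zero_iff]
      exact (h p hp).trans (mul_le_of_le_one_right hD (pow_le_one₀ e0.le ε.2.2))
    have hd : ∀ z : ℝ, HasDerivAt (fun z => Φ (p, z)) (fderiv ℝ Φ (p, z) (0, 1)) z := fun z =>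
      (hΦ.differentiable (by simp) (p, z)).hasFDerivAt.comp_hasDerivAt z
        ((hasDerivAt_const z p).prodMk (hasDerivAt_id z))
    have := Convex.norm_image_sub_le_of_norm_deriv_le (s := Metric.closedBall (0 : ℝ) D)
      (fun z _ => (hd z).differentiableAt) (C := |C|) (fun z hz => by
        rw [(hd z).deriv]
        exact (hC (p, z) ⟨hp, hz⟩).trans (le_abs_self C)) (convex_closedBall 0 D)
      (Metric.mem_closedBall_self hD) hwD
    rw [h0, sub_zero, sub_zero] at this
    rw [mul_assoc]
    exact this.trans (mul_le_mul_of_nonneg_left (h p hp) (abs_nonneg C))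
  | succ k ih =>
    intro Φ w hΦ h0 hw
    have hdir : ∀ v : E × ℝ, ContDiff ℝ ∞ fun z => fderiv ℝ Φ z v := fun v =>
      (hΦ.fderiv_right (m := ∞) (by simp)).clm_apply contDiff_const
    have hw' : BigO q k w := hw.mono le_rfl (Nat.le_succ k)
    have hkz : BigO q 0 fun ε p => Φ (p, w ε p) := by
      have h : BigO q k fun ε p => Φ (p, w ε p) := ih hΦ h0 hw'
      exact h.mono le_rfl (Nat.zero_le _)
    refine hkz.succ fun e => ?_
    -- A derivative of Φ along E again vanishes on z = 0, so the induction hypothesis applies to it;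
    -- the z-derivative need not vanish but comes multiplied by a derivative of w.
    have h1 : BigO q k fun ε p => fderiv ℝ Φ (p, w ε p) (e, 0) := by
      refine ih (hdir (e, 0)) (fun p => ?_) hw'
      have hc : HasFDerivAt (fun p : E => Φ (p, 0)) _ p :=
        HasFDerivAt.comp (f := fun p : E => (p, (0 : ℝ))) p
          (hΦ.differentiable (by simp) (p, 0)).hasFDerivAt
          ((hasFDerivAt_id p).prodMk (hasFDerivAt_const (0 : ℝ) p))
      simp only [h0] at hc
      have := congrArg (fun L => L e) (hc.unique (hasFDerivAt_const (0 : ℝ) p))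
      simpa using this
    have h2 : BigO 0 k fun ε p => fderiv ℝ Φ (p, w ε p) (0, 1) :=
      (bigO_const k (hdir (0, 1))).comp ((hid k).prodMk (hw'.mono (Nat.zero_le _) le_rfl))
    have h3 := h1.add (h2.mul (hw.fderiv_apply e))
    convert h3 using 3 with ε p
    have hc : HasFDerivAt (fun p : E => Φ (p, w ε p)) _ p :=
      (hΦ.differentiable (by simp) (p, w ε p)).hasFDerivAt.comp p
        ((hasFDerivAt_id p).prodMk ((hw.smooth ε).differentiable (by simp) p).hasFDerivAt)
    rw [hc.fderiv]
    simp only [ContinuousLinearMap.comp_apply, ContinuousLinearMap.prod_apply,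
      ContinuousLinearMap.id_apply]
    rw [show (e, fderiv ℝ (w ε) p e) = (e, (0 : ℝ)) + fderiv ℝ (w ε) p e • ((0 : E), (1 : ℝ)) by
      ext <;> simp, map_add, map_smul, smul_eq_mul, mul_comm]

/-- Division by a family which is locally bounded away from zero. -/
theorem BigO.of_mul {q : ℕ} (k : ℕ) : ∀ {a u : Idx → ℝ → ℝ}, (∀ ε, ContDiff ℝ ∞ (u ε)) →
    BigO 0 k a →
    (∀ K : Set ℝ, IsCompact K → ∃ c > 0, ∀ᶠ ε in nearZero, ∀ x ∈ K, c ≤ |a ε x|) →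
    BigO q k (fun ε x => a ε x * u ε x) → BigO q k u := by
  induction k with
  | zero =>
    intro a u hu ha hlow hau
    refine bigO_zero_order hu fun K hK => ?_
    obtain ⟨c, hc, h⟩ := hlow K hK
    obtain ⟨D, hD, h'⟩ := hau.bound_zero hK
    refine ⟨D / c, by positivity, ?_⟩
    filter_upwards [h, h'] with ε h h' x hx
    have h1 := h' x hx
    rw [norm_mul, Real.norm_eq_abs (a ε x)] at h1
    rw [div_mul_eq_mul_div, le_div_iff₀ hc, mul_comm]
    exact (mul_le_mul_of_nonneg_right (h x hx) (norm_nonneg _)).trans h1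
  | succ k ih =>
    intro a u hu ha hlow hau
    have ha' := ha.mono le_rfl (Nat.le_succ k)
    have huk : BigO q k u := ih hu ha' hlow (hau.mono le_rfl (Nat.le_succ k))
    refine (huk.mono le_rfl (Nat.zero_le k)).succ_real (ih (fun ε => ?_) ha' hlow ?_)
    · exact (contDiff_infty_iff_deriv.1 (hu ε)).2
    -- a u' = (a u)' - a' u, where u is already controlled up to order k.
    · have h1 := hau.deriv.sub (ha.deriv.mul huk)
      convert h1 using 3 with ε x
      rw [deriv_fun_mul ((ha.smooth ε).differentiable (by simp) x)
        ((hu ε).differentiable (by simp) x)]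
      ring

theorem bigO_of_isNegligible {u : Idx → E → ℝ} (hs : ∀ ε, ContDiff ℝ ∞ (u ε))
    (hu : IsNegligible u) (q k : ℕ) : BigO q k u := by
  refine ⟨hs, fun K hK => ?_⟩
  obtain ⟨D, hD, μ, hμ, h⟩ := hu.uniform hK k q
  exact ⟨D, hD.le, eventually_nearZero.2 ⟨μ, hμ, h⟩⟩

theorem isNegligible_of_bigO {u : Idx → E → ℝ} (hu : ∀ q k, BigO q k u) : IsNegligible u := by
  intro K hK l q
  obtain ⟨D, hD, h⟩ := (hu q l).bound K hK
  obtain ⟨μ, hμ, h⟩ := eventually_nearZero.1 h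
  refine ⟨D + 1, by positivity, μ, hμ, fun ε hε x hx => (h ε hε x hx l le_rfl).trans ?_⟩
  have e0 : (0 : ℝ) < ε := ε.2.1
  exact mul_le_mul_of_nonneg_right (by linarith) (by positivity)

end Growth

/-! ### Partial derivatives of smooth functions of two variables -/

section Partial

/-- The partial derivative in the first variable. -/
noncomputable def partialX (u : ℝ × ℝ → ℝ) (p : ℝ × ℝ) : ℝ := fderiv ℝ u p (1, 0)

/-- The partial derivative in the second variable. -/
noncomputable def partialY (u : ℝ × ℝ → ℝ) (p : ℝ × ℝ) : ℝ := fderiv ℝ u p (0, 1)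

variable {u v : ℝ × ℝ → ℝ}

theorem contDiff_fderiv_apply (hu : ContDiff ℝ ∞ u) (e : ℝ × ℝ) :
    ContDiff ℝ ∞ fun p => fderiv ℝ u p e :=
  (hu.fderiv_right (m := ∞) (by simp)).clm_apply contDiff_const

theorem contDiff_partialX (hu : ContDiff ℝ ∞ u) : ContDiff ℝ ∞ (partialX u) :=
  contDiff_fderiv_apply hu _

theorem contDiff_partialY (hu : ContDiff ℝ ∞ u) : ContDiff ℝ ∞ (partialY u) :=
  contDiff_fderiv_apply hu _

theorem hasDerivAt_partialX (hu : ContDiff ℝ ∞ u) (x y : ℝ) :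
    HasDerivAt (fun s => u (s, y)) (partialX u (x, y)) x :=
  (hu.differentiable (by simp) (x, y)).hasFDerivAt.comp_hasDerivAt x
    ((hasDerivAt_id x).prodMk (hasDerivAt_const x y))

theorem hasDerivAt_partialY (hu : ContDiff ℝ ∞ u) (x y : ℝ) :
    HasDerivAt (fun t => u (x, t)) (partialY u (x, y)) y :=
  (hu.differentiable (by simp) (x, y)).hasFDerivAt.comp_hasDerivAt y
    ((hasDerivAt_const y x).prodMk (hasDerivAt_id y))

theorem partialX_sub (hu : ContDiff ℝ ∞ u) (hv : ContDiff ℝ ∞ v) :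
    partialX (fun p => u p - v p) = fun p => partialX u p - partialX v p := by
  funext p
  unfold partialX
  rw [fderiv_fun_sub (hu.differentiable (by simp) p) (hv.differentiable (by simp) p),
    sub_apply]

theorem partialY_sub (hu : ContDiff ℝ ∞ u) (hv : ContDiff ℝ ∞ v) :
    partialY (fun p => u p - v p) = fun p => partialY u p - partialY v p := by
  funext p
  unfold partialY
  rw [fderiv_fun_sub (hu.differentiable (by simp) p) (hv.differentiable (by simp) p),
    sub_apply]

theorem partialX_partialY_comm (hu : ContDiff ℝ ∞ u) :
    partialX (partialY u) = partialY (partialX u) := by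
  have hd : ContDiff ℝ ∞ (fderiv ℝ u) := hu.fderiv_right (m := ∞) (by simp)
  have h : ∀ e e' p, fderiv ℝ (fun q => fderiv ℝ u q e) p e' = fderiv ℝ (fderiv ℝ u) p e' e := by
    intro e e' p
    have := (hd.differentiable (by simp) p).hasFDerivAt.clm_apply (hasFDerivAt_const e p)
    rw [this.fderiv]
    simp
  funext p
  unfold partialX partialY
  rw [h, h]
  exact second_derivative_symmetric (fun y => (hu.differentiable (by simp) y).hasFDerivAt)
    (hd.differentiable (by simp) p).hasFDerivAt _ _

theorem hasDerivAt_along_curve (hu : ContDiff ℝ ∞ u) {c : ℝ → ℝ} (hc : ContDiff ℝ ∞ c) (x : ℝ) :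
    HasDerivAt (fun x => u (x, c x))
      (partialX u (x, c x) + partialY u (x, c x) * deriv c x) x := by
  have h := HasFDerivAt.comp_hasDerivAt (f := fun x => (x, c x)) x
    (hu.differentiable (by simp) (x, c x)).hasFDerivAt
    ((hasDerivAt_id x).prodMk (hc.differentiable (by simp) x).hasDerivAt)
  refine h.congr_deriv ?_
  unfold partialX partialY
  rw [show ((1 : ℝ), deriv c x) = ((1 : ℝ), (0 : ℝ)) + deriv c x • ((0 : ℝ), (1 : ℝ)) by
    ext <;> simp, map_add, map_smul, smul_eq_mul, mul_comm (deriv c x)]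

theorem dy_eq_partialY (hu : ContDiff ℝ ∞ u) (x y : ℝ) : dy u x y = partialY u (x, y) :=
  (hasDerivAt_partialY hu x y).deriv

theorem dxdy_eq_partial (hu : ContDiff ℝ ∞ u) (x y : ℝ) :
    dxdy u x y = partialX (partialY u) (x, y) := by
  unfold dxdy
  simp_rw [dy_eq_partialY hu]
  exact (hasDerivAt_partialX (contDiff_partialY hu) x y).deriv

end Partial

/-! ### A Gronwall estimate from data on a curve -/

section Gronwall

/-- A Gronwall estimate for `∂²w/∂x∂y = G`, `|G| ≤ L|w| + δ`, with data on the curve `y = c(x)`. -/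
theorem abs_le_of_goursat {w q G : ℝ × ℝ → ℝ} {c : ℝ → ℝ} (hw : Continuous w) (hG : Continuous G)
    (hc : Continuous c) (hy : ∀ x y, HasDerivAt (fun t => w (x, t)) (q (x, y)) y)
    (hx : ∀ x y, HasDerivAt (fun s => q (s, y)) (G (x, y)) x) {a b m L δ : ℝ} (hab : a ≤ b)
    (hm : 0 ≤ m) (hL : 0 ≤ L) (hδ : 0 ≤ δ) (hcm : ∀ x ∈ Set.Icc a b, |c x| ≤ m)
    (hGle : ∀ x ∈ Set.Icc a b, ∀ y, |y| ≤ m → |G (x, y)| ≤ L * |w (x, y)| + δ)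
    (hw₀ : ∀ x ∈ Set.Icc a b, |w (x, c x)| ≤ δ) (hq₀ : ∀ x ∈ Set.Icc a b, |q (x, c x)| ≤ δ) :
    ∀ x ∈ Set.Icc a b, ∀ ξ ∈ Set.Icc a b,
      |w (x, c ξ)| ≤ 2 * (1 + 4 * m) * Real.exp ((4 * m * L + 1) * (b - a)) * δ := by
  -- Only the integration in x gains a factor 1/l; the one in y costs the length 2m. Thus l is
  -- chosen so that 2m L / l ≤ 1/2.
  set l : ℝ := 4 * m * L + 1 with hl_def
  have hl1 : 1 ≤ l := by rw [hl_def]; nlinarith [mul_nonneg hm hL]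
  have hl0 : 0 < l := by linarith
  -- The height is parametrized as y = c(ξ), so that |x - ξ| measures the distance to the curve
  -- along a horizontal line. No monotonicity of c is required.
  obtain ⟨⟨x₀, ξ₀⟩, ⟨hx₀, hξ₀⟩, hmax⟩ := (isCompact_Icc.prod isCompact_Icc).exists_isMaxOn
    (s := Set.Icc a b ×ˢ Set.Icc a b) ⟨(a, a), ⟨le_rfl, hab⟩, le_rfl, hab⟩
    (f := fun p : ℝ × ℝ => |w (p.1, c p.2)| * Real.exp (-(l * |p.1 - p.2|)))
    (by fun_prop : Continuous fun p : ℝ × ℝ =>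
      |w (p.1, c p.2)| * Real.exp (-(l * |p.1 - p.2|))).continuousOn
  set M : ℝ := |w (x₀, c ξ₀)| * Real.exp (-(l * |x₀ - ξ₀|)) with hM_def
  have hM0 : 0 ≤ M := by positivity
  have hWM : ∀ x ∈ Set.Icc a b, ∀ ξ ∈ Set.Icc a b,
      |w (x, c ξ)| ≤ M * Real.exp (l * |x - ξ|) := by
    intro x hx ξ hξ
    have h : |w (x, c ξ)| * Real.exp (-(l * |x - ξ|)) ≤ M := hmax (Set.mk_mem_prod hx hξ)
    rwa [Real.exp_neg, ← div_eq_mul_inv, div_le_iff₀ (Real.exp_pos _)] at h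
  have hE : ∀ s t : ℝ, 1 ≤ Real.exp (l * |s - t|) := fun s t => Real.one_le_exp (by positivity)
  have hq : ∀ x ∈ Set.Icc a b, ∀ η ∈ Set.Icc a b,
      |q (x, c η)| ≤ (L * M / l + 2 * δ) * Real.exp (l * |x - η|) := by
    intro x hxI η hη
    have hGc : Continuous fun s => G (s, c η) := hG.comp (by fun_prop)
    have hint : ∫ s in η..x, G (s, c η) = q (x, c η) - q (η, c η) :=
      intervalIntegral.integral_eq_sub_of_hasDerivAt (fun s _ => hx s (c η))
        (hGc.intervalIntegrable _ _)
    have h1 := abs_integral_le_exp (a := η) (b := x) (g := fun s => G (s, c η))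
      (M := L * M + δ) hl0 (by positivity) (by
        intro s hs
        have hsI := Set.uIcc_subset_Icc hη hxI hs
        have h2 := hGle s hsI (c η) (hcm η hη)
        have h3 := mul_le_mul_of_nonneg_left (hWM s hsI η hη) hL
        have h4 := mul_le_mul_of_nonneg_left (hE s η) hδ
        calc |G (s, c η)| ≤ L * |w (s, c η)| + δ := h2
          _ ≤ (L * M + δ) * Real.exp (l * |s - η|) := by linarith)
    rw [hint] at h1
    have h2 := hq₀ η hη
    have h3 : |q (x, c η)| ≤ |q (x, c η) - q (η, c η)| + |q (η, c η)| := by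
      simpa using abs_add_le (q (x, c η) - q (η, c η)) (q (η, c η))
    have h4 := mul_le_mul_of_nonneg_left (hE x η) hδ
    have h5 : (L * M + δ) / l ≤ L * M / l + δ := by
      rw [add_div]
      have := div_le_self hδ hl1
      linarith
    have h6 := mul_le_mul_of_nonneg_right h5 (Real.exp_pos (l * |x - η|)).le
    linarith
  have hwb : ∀ x ∈ Set.Icc a b, ∀ ξ ∈ Set.Icc a b, |w (x, c ξ)| ≤
      ((1 + 4 * m) * δ + M / 2) * Real.exp (l * |x - ξ|) := by
    intro x hxI ξ hξ
    -- Every height between c(x) and c(ξ) equals c(η) for some η between x and ξ, so |x - η| ≤ |x -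
    -- ξ| and the weight at η is dominated.
    have h1 := Convex.norm_image_sub_le_of_norm_deriv_le (s := Set.uIcc (c x) (c ξ))
      (fun t _ => (hy x t).differentiableAt)
      (C := (L * M / l + 2 * δ) * Real.exp (l * |x - ξ|)) (by
        intro t ht
        obtain ⟨η, hη, rfl⟩ := intermediate_value_uIcc hc.continuousOn ht
        rw [(hy x (c η)).deriv]
        refine (hq x hxI η (Set.uIcc_subset_Icc hxI hξ hη)).trans ?_
        refine mul_le_mul_of_nonneg_left (Real.exp_le_exp.2 ?_) (by positivity)
        refine mul_le_mul_of_nonneg_left ?_ hl0.le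
        rw [abs_sub_comm x η, abs_sub_comm x ξ]
        exact Set.abs_sub_left_of_mem_uIcc hη) (convex_uIcc _ _) Set.left_mem_uIcc
        Set.right_mem_uIcc
    rw [Real.norm_eq_abs, Real.norm_eq_abs] at h1
    have h2 : |c ξ - c x| ≤ 2 * m := by
      have := hcm x hxI; have := hcm ξ hξ
      refine (abs_sub _ _).trans ?_
      linarith
    have h3 : |w (x, c ξ)| ≤ |w (x, c ξ) - w (x, c x)| + |w (x, c x)| := by
      simpa using abs_add_le (w (x, c ξ) - w (x, c x)) (w (x, c x))
    have h4 := hw₀ x hxI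
    have h5 := mul_le_mul_of_nonneg_left (hE x ξ) hδ
    have h6 : 2 * m * (L * M / l) ≤ M / 2 := by
      rw [← mul_div_assoc, div_le_div_iff₀ hl0 two_pos, hl_def]
      nlinarith
    have h7 := mul_le_mul_of_nonneg_right h6 (Real.exp_pos (l * |x - ξ|)).le
    have h8 := mul_le_mul_of_nonneg_left h2
      (by positivity : 0 ≤ (L * M / l + 2 * δ) * Real.exp (l * |x - ξ|))
    calc |w (x, c ξ)| ≤ (L * M / l + 2 * δ) * Real.exp (l * |x - ξ|) * (2 * m) +
          δ * Real.exp (l * |x - ξ|) := by linarith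
      _ = 2 * m * (L * M / l) * Real.exp (l * |x - ξ|) +
          (1 + 4 * m) * δ * Real.exp (l * |x - ξ|) := by ring
      _ ≤ _ := by linarith
  -- At the maximum point the bound reproduces M with factor 1/2, which is absorbed on the left.
  have hMle : M ≤ (1 + 4 * m) * δ + M / 2 := by
    rw [hM_def, Real.exp_neg, ← div_eq_mul_inv, div_le_iff₀ (Real.exp_pos _)]
    have := hwb x₀ hx₀ ξ₀ hξ₀
    rwa [hM_def, Real.exp_neg, ← div_eq_mul_inv] at this
  intro x hx ξ hξ
  have h1 := hWM x hx ξ hξ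
  have h2 : Real.exp (l * |x - ξ|) ≤ Real.exp (l * (b - a)) := by
    refine Real.exp_le_exp.2 (mul_le_mul_of_nonneg_left ?_ hl0.le)
    rw [abs_le]
    constructor <;> linarith [hx.1, hx.2, hξ.1, hξ.2]
  calc |w (x, c ξ)| ≤ M * Real.exp (l * |x - ξ|) := h1
    _ ≤ (2 * (1 + 4 * m) * δ) * Real.exp (l * (b - a)) :=
        mul_le_mul (by linarith) h2 (Real.exp_pos _).le (by positivity)
    _ = _ := by ring

end Gronwall

/-! ### Integrating smallness away from a family of curves -/

section Transport

/-- A family of curves converging rapidly to the non-characteristic curve `y = f(x)`. -/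
structure IsCurveFamily (f : Smooth ℝ) (c : Idx → ℝ → ℝ) : Prop where
  nonChar : IsNonCharacteristic f
  smooth : ∀ ε, ContDiff ℝ ∞ (c ε)
  sub : ∀ q k, BigO q k fun ε x => c ε x - f.1 x

variable {f : Smooth ℝ} {c : Idx → ℝ → ℝ}

theorem IsCurveFamily.bigO (h : IsCurveFamily f c) (k : ℕ) : BigO 0 k c := by
  simpa using (h.sub 0 k).add (bigO_const k (contDiff_coe f))

theorem IsCurveFamily.bigO_graph (h : IsCurveFamily f c) (k : ℕ) :
    BigO 0 k fun ε x => (x, c ε x) :=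
  (bigO_const k contDiff_id).prodMk (h.bigO k)

theorem BigO.eventually_abs_le {u : Idx → ℝ → ℝ} (hu : BigO 1 0 u) {K : Set ℝ} (hK : IsCompact K)
    {r : ℝ} (hr : 0 < r) : ∀ᶠ ε in nearZero, ∀ x ∈ K, |u ε x| ≤ r := by
  obtain ⟨D, hD, h⟩ := hu.bound_zero hK
  filter_upwards [h, eventually_mul_lt D hr] with ε h h' x hx
  have := h x hx
  rw [pow_one] at this
  exact this.trans h'.le

/-- On K, |f'| has a positive minimum, and c_ε' is within half of a lower bound for it once ε is
small. -/
theorem IsCurveFamily.deriv_lower (h : IsCurveFamily f c) (K : Set ℝ) (hK : IsCompact K) :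
    ∃ r > 0, ∀ᶠ ε in nearZero, ∀ x ∈ K, r ≤ |deriv (c ε) x| := by
  have hf' : ContDiff ℝ ∞ (deriv (f : ℝ → ℝ)) := (contDiff_infty_iff_deriv.1 (contDiff_coe f)).2
  obtain ⟨C, hC⟩ := hK.exists_bound_of_continuousOn
    (hf'.continuous.inv₀ h.nonChar.1 : Continuous fun x => (deriv (f : ℝ → ℝ) x)⁻¹).continuousOn
  have hr : 0 < 1 / (|C| + 1) := by positivity
  refine ⟨1 / (|C| + 1) / 2, by positivity, ?_⟩
  filter_upwards [((h.sub 1 1).deriv).eventually_abs_le hK (half_pos hr)] with ε hε x hx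
  have h1 := hε x hx
  rw [deriv_fun_sub ((h.smooth ε).differentiable (by simp) x)
    ((contDiff_coe f).differentiable (by simp) x)] at h1
  have h2 : 1 / (|C| + 1) ≤ |deriv (f : ℝ → ℝ) x| := by
    have h3 := hC x hx
    rw [Pi.inv_apply, norm_inv, Real.norm_eq_abs] at h3
    have h4 : 0 < |deriv (f : ℝ → ℝ) x| := abs_pos.2 (h.nonChar.1 x)
    rw [div_le_iff₀ (by positivity)]
    rw [inv_eq_one_div, div_le_iff₀ h4] at h3
    nlinarith [le_abs_self C]
  have h3 := abs_sub_abs_le_abs_sub (deriv (f : ℝ → ℝ) x) (deriv (c ε) x)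
  rw [abs_sub_comm] at h3
  linarith

/-- This gives one box, independent of ε, in which every point of K can be joined to the curve both
horizontally and vertically. Surjectivity is used only for f; that of c_ε is replaced by the
intermediate value theorem. -/
theorem IsCurveFamily.exists_cover (h : IsCurveFamily f c) {K : Set (ℝ × ℝ)} (hK : IsCompact K) :
    ∃ a b m : ℝ, a ≤ b ∧ 0 ≤ m ∧ ∀ᶠ ε in nearZero, (∀ x ∈ Set.Icc a b, |c ε x| ≤ m) ∧
      ∀ p ∈ K, p.1 ∈ Set.Icc a b ∧ ∃ ξ ∈ Set.Icc a b, c ε ξ = p.2 := by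
  obtain ⟨R', hR'⟩ := hK.isBounded.exists_norm_le
  set R := max R' 0 with hR
  have hR0 : 0 ≤ R := le_max_right _ _
  have hRK : ∀ p ∈ K, ‖p‖ ≤ R := fun p hp => (hR' p hp).trans (le_max_left _ _)
  -- The margin 1 absorbs |c_ε - f| ≤ 1, so c_ε still takes every value in [-R, R].
  obtain ⟨α, hα⟩ := h.nonChar.2 (R + 1)
  obtain ⟨β, hβ⟩ := h.nonChar.2 (-(R + 1))
  set r := max R (max |α| |β|)
  have hrR : R ≤ r := le_max_left _ _
  have hαr : α ∈ Set.Icc (-r) r := abs_le.1 ((le_max_left _ _).trans (le_max_right _ _))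
  have hβr : β ∈ Set.Icc (-r) r := abs_le.1 ((le_max_right _ _).trans (le_max_right _ _))
  obtain ⟨C, hC⟩ := (isCompact_Icc (a := -r) (b := r)).exists_bound_of_continuousOn
    (contDiff_coe f).continuous.continuousOn
  refine ⟨-r, r, |C| + 1, by linarith, by positivity, ?_⟩
  filter_upwards [(h.sub 1 0).eventually_abs_le (isCompact_Icc (a := -r) (b := r)) one_pos]
    with ε hε
  refine ⟨fun x hx => ?_, fun p hp => ⟨?_, ?_⟩⟩
  · have h1 := hε x hx
    have h2 : |f.1 x| ≤ C := hC x hx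
    have h3 : |c ε x| ≤ |c ε x - f.1 x| + |f.1 x| := by
      simpa using abs_add_le (c ε x - f.1 x) (f.1 x)
    linarith [le_abs_self C]
  · exact abs_le.1 ((norm_fst_le p).trans ((hRK p hp).trans hrR))
  · have h1 := abs_le.1 (hε α hαr)
    have h2 := abs_le.1 (hε β hβr)
    have h3 := abs_le.1 ((norm_snd_le p).trans (hRK p hp))
    rw [hα] at h1
    rw [hβ] at h2
    obtain ⟨ξ, hξ, he⟩ := intermediate_value_uIcc (a := β) (b := α) (f := c ε)
      (h.smooth ε).continuous.continuousOn
      (Set.mem_uIcc_of_le (by linarith [h3.1, h2.2]) (by linarith [h3.2, h1.1]) :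
        p.2 ∈ Set.uIcc (c ε β) (c ε α))
    exact ⟨ξ, Set.uIcc_subset_Icc hβr hαr hξ, he⟩

theorem BigO.partialX {q k : ℕ} {u : Idx → ℝ × ℝ → ℝ} (hu : BigO q (k + 1) u) :
    BigO q k fun ε => partialX (u ε) := hu.fderiv_apply _

theorem BigO.partialY {q k : ℕ} {u : Idx → ℝ × ℝ → ℝ} (hu : BigO q (k + 1) u) :
    BigO q k fun ε => partialY (u ε) := hu.fderiv_apply _

/-- A family with small `x`-derivative and small restriction to the curves is small. -/
theorem IsCurveFamily.bigO_of_partialX (h : IsCurveFamily f c) {q : ℕ} (k : ℕ) :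
    ∀ {P : Idx → ℝ × ℝ → ℝ}, (∀ ε, ContDiff ℝ ∞ (P ε)) →
      BigO q k (fun ε => Colombeau.partialX (P ε)) → BigO q k (fun ε x => P ε (x, c ε x)) →
      BigO q k P := by
  induction k with
  | zero =>
    intro P hP hG hC
    refine bigO_zero_order hP fun K hK => ?_
    obtain ⟨a, b, m, hab, hm, hcov⟩ := h.exists_cover hK
    obtain ⟨D, hD, hG⟩ := hG.bound_zero
      ((isCompact_Icc (a := a) (b := b)).prod (isCompact_Icc (a := -m) (b := m)))
    obtain ⟨D', hD', hC⟩ := hC.bound_zero (isCompact_Icc (a := a) (b := b))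
    have hba : 0 ≤ b - a := sub_nonneg.2 hab
    refine ⟨D * (b - a) + D', by positivity, ?_⟩
    filter_upwards [hcov, hG, hC] with ε hcov hG hC p hp
    have e0 : (0 : ℝ) < ε := ε.2.1
    obtain ⟨hp1, ξ, hξ, hξp⟩ := hcov.2 p hp
    have hp2 : p.2 ∈ Set.Icc (-m) m := by rw [← hξp]; exact abs_le.1 (hcov.1 ξ hξ)
    have h1 := Convex.norm_image_sub_le_of_norm_deriv_le (s := Set.Icc a b)
      (fun s _ => (hasDerivAt_partialX (hP ε) s p.2).differentiableAt)
      (C := D * (ε : ℝ) ^ q) (by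
        intro s hs
        rw [(hasDerivAt_partialX (hP ε) s p.2).deriv]
        exact hG (s, p.2) ⟨hs, hp2⟩) (convex_Icc a b) hξ hp1
    have h2 := hC ξ hξ
    rw [hξp] at h2
    have h3 : ‖p.1 - ξ‖ ≤ b - a := by
      rw [Real.norm_eq_abs, abs_le]
      constructor <;> linarith [hp1.1, hp1.2, hξ.1, hξ.2]
    have h4 := mul_le_mul_of_nonneg_left h3 (by positivity : 0 ≤ D * (ε : ℝ) ^ q)
    have h5 : ‖P ε p‖ ≤ ‖P ε p - P ε (ξ, p.2)‖ + ‖P ε (ξ, p.2)‖ := by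
      simpa using norm_add_le (P ε p - P ε (ξ, p.2)) (P ε (ξ, p.2))
    have h6 : ‖P ε p - P ε (ξ, p.2)‖ ≤ D * (ε : ℝ) ^ q * ‖p.1 - ξ‖ := h1
    calc ‖P ε p‖ ≤ D * (ε : ℝ) ^ q * (b - a) + D' * (ε : ℝ) ^ q := by linarith
      _ = _ := by ring
  | succ k ih =>
    intro P hP hG hC
    have hGk := hG.mono le_rfl (Nat.le_succ k)
    have hPk : BigO q k P := ih hP hGk (hC.mono le_rfl (Nat.le_succ k))
    -- The derivative ∂P/∂y satisfies the same hypotheses one order lower: its x-derivative is ∂/∂y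
    -- of ∂P/∂x, and its trace comes from differentiating P(x, c(x)) and dividing by c'.
    refine (hPk.mono le_rfl (Nat.zero_le k)).succ_prod hGk
      (ih (P := fun ε => Colombeau.partialY (P ε)) (fun ε => contDiff_partialY (hP ε)) ?_ ?_)
    · simp_rw [partialX_partialY_comm (hP _)]
      exact hG.partialY
    · refine BigO.of_mul k (a := fun ε => deriv (c ε)) (fun ε => (contDiff_partialY (hP ε)).comp
        (contDiff_id.prodMk (h.smooth ε))) (h.bigO (k + 1)).deriv h.deriv_lower ?_
      have h1 := hC.deriv.sub (hGk.comp (h.bigO_graph k))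
      convert h1 using 3 with ε x
      rw [(hasDerivAt_along_curve (hP ε) (h.smooth ε) x).deriv]
      ring

/-- A family with small `y`-derivative and small restriction to the curves is small. -/
theorem IsCurveFamily.bigO_of_partialY (h : IsCurveFamily f c) {q : ℕ} (k : ℕ) :
    ∀ {P : Idx → ℝ × ℝ → ℝ}, (∀ ε, ContDiff ℝ ∞ (P ε)) →
      BigO q k (fun ε => Colombeau.partialY (P ε)) → BigO q k (fun ε x => P ε (x, c ε x)) →
      BigO q k P := by
  induction k with
  | zero =>
    intro P hP hG hC
    refine bigO_zero_order hP fun K hK => ?_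
    obtain ⟨a, b, m, hab, hm, hcov⟩ := h.exists_cover hK
    obtain ⟨D, hD, hG⟩ := hG.bound_zero
      ((isCompact_Icc (a := a) (b := b)).prod (isCompact_Icc (a := -m) (b := m)))
    obtain ⟨D', hD', hC⟩ := hC.bound_zero (isCompact_Icc (a := a) (b := b))
    refine ⟨D * (2 * m) + D', by positivity, ?_⟩
    filter_upwards [hcov, hG, hC] with ε hcov hG hC p hp
    have e0 : (0 : ℝ) < ε := ε.2.1
    obtain ⟨hp1, ξ, hξ, hξp⟩ := hcov.2 p hp
    have hp2 : p.2 ∈ Set.Icc (-m) m := by rw [← hξp]; exact abs_le.1 (hcov.1 ξ hξ)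
    have hc2 : c ε p.1 ∈ Set.Icc (-m) m := abs_le.1 (hcov.1 p.1 hp1)
    have h1 := Convex.norm_image_sub_le_of_norm_deriv_le (s := Set.Icc (-m) m)
      (fun t _ => (hasDerivAt_partialY (hP ε) p.1 t).differentiableAt)
      (C := D * (ε : ℝ) ^ q) (by
        intro t ht
        rw [(hasDerivAt_partialY (hP ε) p.1 t).deriv]
        exact hG (p.1, t) ⟨hp1, ht⟩) (convex_Icc _ _) hc2 hp2
    have h2 := hC p.1 hp1
    have h3 : ‖p.2 - c ε p.1‖ ≤ 2 * m := by
      rw [Real.norm_eq_abs, abs_le]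
      constructor <;> linarith [hp2.1, hp2.2, hc2.1, hc2.2]
    have h4 := mul_le_mul_of_nonneg_left h3 (by positivity : 0 ≤ D * (ε : ℝ) ^ q)
    have h5 : ‖P ε p‖ ≤ ‖P ε p - P ε (p.1, c ε p.1)‖ + ‖P ε (p.1, c ε p.1)‖ := by
      simpa using norm_add_le (P ε p - P ε (p.1, c ε p.1)) (P ε (p.1, c ε p.1))
    have h6 : ‖P ε p - P ε (p.1, c ε p.1)‖ ≤ D * (ε : ℝ) ^ q * ‖p.2 - c ε p.1‖ := h1
    calc ‖P ε p‖ ≤ D * (ε : ℝ) ^ q * (2 * m) + D' * (ε : ℝ) ^ q := by linarith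
      _ = _ := by ring
  | succ k ih =>
    intro P hP hG hC
    have hGk := hG.mono le_rfl (Nat.le_succ k)
    have hPk : BigO q k P := ih hP hGk (hC.mono le_rfl (Nat.le_succ k))
    refine (hPk.mono le_rfl (Nat.zero_le k)).succ_prod
      (ih (P := fun ε => Colombeau.partialX (P ε)) (fun ε => contDiff_partialX (hP ε)) ?_ ?_) hGk
    · simp_rw [← partialX_partialY_comm (hP _)]
      exact hG.partialX
    -- Here the unknown trace is that of ∂P/∂x, whose coefficient along the curve is 1, so no
    -- division by c' occurs.
    · have h1 := hC.deriv.sub ((h.bigO (k + 1)).deriv.mul (hGk.comp (h.bigO_graph k)))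
      convert h1 using 3 with ε x
      rw [(hasDerivAt_along_curve (hP ε) (h.smooth ε) x).deriv]
      ring

end Transport

/-! ### Comparison with the limit solution -/

section Comparison

variable {f : Smooth ℝ} {c : Idx → ℝ → ℝ}

theorem IsCurveFamily.bigO_zero_of_goursat (h : IsCurveFamily f c) {q : ℕ}
    {w : Idx → ℝ × ℝ → ℝ} (hw : ∀ ε, ContDiff ℝ ∞ (w ε))
    (hG : ∀ K : Set (ℝ × ℝ), IsCompact K → ∃ L ≥ 0, ∃ D ≥ 0, ∀ᶠ ε in nearZero, ∀ p ∈ K,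
      |partialX (partialY (w ε)) p| ≤ L * |w ε p| + D * (ε : ℝ) ^ q)
    (hw₀ : BigO q 0 fun ε x => w ε (x, c ε x))
    (hq₀ : BigO q 0 fun ε x => partialY (w ε) (x, c ε x)) : BigO q 0 w := by
  refine bigO_zero_order hw fun K hK => ?_
  obtain ⟨a, b, m, hab, hm, hcov⟩ := h.exists_cover hK
  obtain ⟨L, hL, D, hD, hG⟩ := hG _
    ((isCompact_Icc (a := a) (b := b)).prod (isCompact_Icc (a := -m) (b := m)))
  obtain ⟨D₀, hD₀, hw₀⟩ := hw₀.bound_zero (isCompact_Icc (a := a) (b := b))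
  obtain ⟨D₁, hD₁, hq₀⟩ := hq₀.bound_zero (isCompact_Icc (a := a) (b := b))
  refine ⟨2 * (1 + 4 * m) * Real.exp ((4 * m * L + 1) * (b - a)) * (D + D₀ + D₁),
    by positivity, ?_⟩
  filter_upwards [hcov, hG, hw₀, hq₀] with ε hcov hG hw₀ hq₀ p hp
  have e0 : (0 : ℝ) < (ε : ℝ) ^ q := pow_pos ε.2.1 q
  obtain ⟨hp1, ξ, hξ, hξp⟩ := hcov.2 p hp
  have k0 := mul_nonneg hD e0.le
  have k1 := mul_nonneg hD₀ e0.le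
  have k2 := mul_nonneg hD₁ e0.le
  have := abs_le_of_goursat (hw ε).continuous
    (contDiff_partialX (contDiff_partialY (hw ε))).continuous (h.smooth ε).continuous
    (hasDerivAt_partialY (hw ε)) (hasDerivAt_partialX (contDiff_partialY (hw ε))) hab hm hL
    (δ := (D + D₀ + D₁) * (ε : ℝ) ^ q) (by positivity) hcov.1
    (fun x hx y hy => (hG (x, y) ⟨hx, abs_le.1 hy⟩).trans (by linarith))
    (fun x hx => (hw₀ x hx).trans (by linarith)) (fun x hx => (hq₀ x hx).trans (by linarith))
    p.1 hp1 ξ hξ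
  rw [hξp, ← mul_assoc] at this
  exact this

/-- Families of approximate solutions along the curves `y = c_ε(x)` differ from the solution along
the limit curve by a negligible family. -/
theorem IsCurveFamily.isNegligible_sub (h : IsCurveFamily f c) (F : Smooth (ℝ × ℝ × ℝ))
    (hF : ∀ K : Set (ℝ × ℝ), IsCompact K →
      ∃ C : ℝ, ∀ p ∈ K, ∀ z : ℝ, |deriv (fun s => F.1 (p.1, p.2, s)) z| ≤ C)
    {φ ψ : Smooth ℝ} {v : Smooth (ℝ × ℝ)} (hv : IsSolution F φ ψ f v)
    {u : Idx → Smooth (ℝ × ℝ)}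
    (h₁ : IsNegligible fun ε (p : ℝ × ℝ) =>
      dxdy (u ε) p.1 p.2 - F.1 (p.1, p.2, (u ε).1 p))
    (h₂ : IsNegligible fun ε (x : ℝ) => (u ε).1 (x, c ε x) - φ.1 x)
    (h₃ : IsNegligible fun ε (x : ℝ) => dy (u ε) x (c ε x) - ψ.1 x) :
    IsNegligible fun ε p => (u ε).1 p - v.1 p := by
  have hus : ∀ ε, ContDiff ℝ ∞ (u ε).1 := fun ε => (u ε).2
  have hvs : ContDiff ℝ ∞ v.1 := v.2
  have hgs : ∀ ε, ContDiff ℝ ∞ fun x => (x, c ε x) := fun ε => contDiff_id.prodMk (h.smooth ε)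
  set w : Idx → ℝ × ℝ → ℝ := fun ε p => (u ε).1 p - v.1 p with hw_def
  have hws : ∀ ε, ContDiff ℝ ∞ (w ε) := fun ε => (hus ε).sub hvs
  have hFc : ∀ {k : ℝ × ℝ → ℝ}, ContDiff ℝ ∞ k → ContDiff ℝ ∞ fun p => F.1 (p.1, p.2, k p) :=
    fun hk => (contDiff_coe F).comp (contDiff_fst.prodMk (contDiff_snd.prodMk hk))
  simp_rw [fun ε (p : ℝ × ℝ) => dxdy_eq_partial (hus ε) p.1 p.2] at h₁
  simp_rw [fun ε x => dy_eq_partialY (hus ε) x (c ε x)] at h₃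
  have b₁ := bigO_of_isNegligible
    (fun ε => (contDiff_partialX (contDiff_partialY (hus ε))).sub (hFc (hus ε))) h₁
  have b₂ := bigO_of_isNegligible (u := fun ε (x : ℝ) => (u ε).1 (x, c ε x) - φ.1 x)
    (fun ε => ((hus ε).comp (hgs ε)).sub (contDiff_coe φ)) h₂
  have b₃ := bigO_of_isNegligible
    (u := fun ε (x : ℝ) => partialY (u ε).1 (x, c ε x) - ψ.1 x)
    (fun ε => ((contDiff_partialY (hus ε)).comp (hgs ε)).sub (contDiff_coe ψ)) h₃
  have hwG : ∀ ε p, partialX (partialY (w ε)) p =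
      (F.1 (p.1, p.2, v.1 p + w ε p) - F.1 (p.1, p.2, v.1 p)) +
      (partialX (partialY (u ε).1) p - F.1 (p.1, p.2, (u ε).1 p)) := by
    intro ε p
    have e := hv.1 p.1 p.2
    rw [dxdy_eq_partial hvs] at e
    rw [hw_def, partialY_sub (hus ε) hvs,
      partialX_sub (contDiff_partialY (hus ε)) (contDiff_partialY hvs)]
    simp only [Prod.mk.eta] at e ⊢
    rw [e, add_sub_cancel]
    ring
  -- Moving the data of v from y = f(x) to y = c_ε(x) costs a negligible error, by substituting z =
  -- c_ε - f in g(x, f(x) + z) - g(x, f(x)).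
  have trace : ∀ {g : ℝ × ℝ → ℝ}, ContDiff ℝ ∞ g → ∀ q k,
      BigO q k fun ε x => g (x, c ε x) - g (x, f.1 x) := by
    intro g hg q k
    have hgf : ContDiff ℝ ∞ fun p : ℝ × ℝ => g (p.1, f.1 p.1 + p.2) - g (p.1, f.1 p.1) :=
      (hg.comp (contDiff_fst.prodMk (((contDiff_coe f).comp contDiff_fst).add contDiff_snd))).sub
        (hg.comp (contDiff_fst.prodMk ((contDiff_coe f).comp contDiff_fst)))
    have := BigO.substitute k hgf (fun p => by simp) (h.sub q k)
    simpa using this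
  have hw₀ : ∀ q k, BigO q k fun ε x => w ε (x, c ε x) := by
    intro q k
    convert (b₂ q k).sub (trace hvs q k) using 3 with ε x
    rw [hv.2.1 x, hw_def]
    ring
  have hq₀ : ∀ q k, BigO q k fun ε x => partialY (w ε) (x, c ε x) := by
    intro q k
    convert (b₃ q k).sub (trace (contDiff_partialY hvs) q k) using 3 with ε x
    have e := hv.2.2 x
    rw [dy_eq_partialY hvs] at e
    rw [e, hw_def, partialY_sub (hus ε) hvs]
    ring
  refine isNegligible_of_bigO fun q k => ?_
  induction k with
  | zero =>
    -- Order zero needs only the Lipschitz bound on F, which is global in z, so no prior bound on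
    -- u_ε enters.
    refine h.bigO_zero_of_goursat hws (fun K hK => ?_) (hw₀ q 0) (hq₀ q 0)
    obtain ⟨L, hL, hLip⟩ := exists_lipschitz F hF hK
    obtain ⟨D, hD, hb⟩ := (b₁ q 0).bound_zero hK
    refine ⟨L, hL.le, D, hD, hb.mono fun ε hb p hp => ?_⟩
    rw [hwG]
    refine (abs_add_le _ _).trans (add_le_add ?_ (hb p hp))
    simpa using hLip p hp (v.1 p + w ε p) (v.1 p)
  | succ k ih =>
    -- The nonlinearity F(x, y, v + z) - F(x, y, v) is smooth and vanishes at z = 0, so the order-k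
    -- bound on w passes to w_xy.
    have hG : BigO q k fun ε => partialX (partialY (w ε)) := by
      have hΦ : ContDiff ℝ ∞ fun p : (ℝ × ℝ) × ℝ =>
          F.1 (p.1.1, p.1.2, v.1 p.1 + p.2) - F.1 (p.1.1, p.1.2, v.1 p.1) :=
        ((contDiff_coe F).comp ((contDiff_fst.comp contDiff_fst).prodMk
          ((contDiff_snd.comp contDiff_fst).prodMk
            ((hvs.comp contDiff_fst).add contDiff_snd)))).sub
        ((hFc hvs).comp contDiff_fst)
      convert (BigO.substitute k hΦ (fun p => by simp) ih).add (b₁ q k) using 3 with ε p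
      exact hwG ε p
    have hwy : BigO q k fun ε => partialY (w ε) :=
      h.bigO_of_partialX k (fun ε => contDiff_partialY (hws ε)) hG (hq₀ q k)
    have hwx : BigO q k fun ε => partialX (w ε) := by
      refine h.bigO_of_partialY k (fun ε => contDiff_partialX (hws ε)) ?_ ?_
      · simp_rw [← partialX_partialY_comm (hws _)]
        exact hG
      · convert (hw₀ q (k + 1)).deriv.sub ((h.bigO (k + 1)).deriv.mul (hq₀ q k)) using 3 with ε x
        rw [(hasDerivAt_along_curve (hws ε) (h.smooth ε) x).deriv]
        ring
    exact (ih.mono le_rfl (Nat.zero_le k)).succ_prod hwx hwy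

theorem isNegligible_of_eq_zero {E : Type} [NormedAddCommGroup E] [NormedSpace ℝ E]
    {u : Idx → E → ℝ} (hu : ∀ ε x, u ε x = 0) : IsNegligible u := by
  rw [show u = fun _ => 0 from funext fun ε => funext fun x => hu ε x]
  exact isNegligible_zero

/-- Exact solutions along the curves `y = c_ε(x)` form a family close to the limit solution. -/
theorem IsCurveFamily.isNegligible_sub_of_isSolution {c : Idx → Smooth ℝ}
    (h : IsCurveFamily f fun ε => (c ε).1) (F : Smooth (ℝ × ℝ × ℝ))
    (hF : ∀ K : Set (ℝ × ℝ), IsCompact K →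
      ∃ C : ℝ, ∀ p ∈ K, ∀ z : ℝ, |deriv (fun s => F.1 (p.1, p.2, s)) z| ≤ C)
    {φ ψ : Smooth ℝ} {v : Smooth (ℝ × ℝ)} (hv : IsSolution F φ ψ f v)
    {u : Idx → Smooth (ℝ × ℝ)} (hu : ∀ ε, IsSolution F φ ψ (c ε) (u ε)) :
    IsNegligible fun ε p => (u ε).1 p - v.1 p :=
  h.isNegligible_sub F hF hv
    (isNegligible_of_eq_zero fun ε p => sub_eq_zero.2 ((hu ε).1 p.1 p.2))
    (isNegligible_of_eq_zero fun ε x => sub_eq_zero.2 ((hu ε).2.1 x))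
    (isNegligible_of_eq_zero fun ε x => sub_eq_zero.2 ((hu ε).2.2 x))

theorem isModerate_of_bigO {E : Type} [NormedAddCommGroup E] [NormedSpace ℝ E]
    {u : Idx → E → ℝ} (hu : ∀ k, BigO 0 k u) : IsModerate u := by
  intro K hK l
  obtain ⟨D, hD, h⟩ := (hu l).bound K hK
  obtain ⟨μ, hμ, h⟩ := eventually_nearZero.1 h
  refine ⟨0, D + 1, by positivity, μ, hμ, fun ε hε x hx => ?_⟩
  have := h ε hε x hx l le_rfl
  rw [pow_zero, mul_one] at this
  rw [pow_zero, div_one]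
  exact this.trans (by linarith)

theorem isModerate_of_isNegligible_sub {E : Type} [NormedAddCommGroup E] [NormedSpace ℝ E]
    {u : Idx → Smooth E} {v : Smooth E} (h : IsNegligible fun ε x => (u ε).1 x - v.1 x) :
    IsModerate fun ε => (u ε : E → ℝ) := by
  refine isModerate_of_bigO fun k => ?_
  have h1 := bigO_of_isNegligible (fun ε => (contDiff_coe (u ε)).sub (contDiff_coe v)) h 0 k
  simpa using h1.add (bigO_const k (contDiff_coe v))

theorem isCurveFamily_const (hf : IsNonCharacteristic f) : IsCurveFamily f fun _ => f.1 :=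
  ⟨hf, fun _ => contDiff_coe f, fun q k => by simpa using bigO_zero q k⟩

/-- Two solutions along one curve, taken as constant families, differ by a negligible family; a
constant bounded by D ε for all small ε is zero. -/
theorem isSolution_unique (F : Smooth (ℝ × ℝ × ℝ))
    (hF : ∀ K : Set (ℝ × ℝ), IsCompact K →
      ∃ C : ℝ, ∀ p ∈ K, ∀ z : ℝ, |deriv (fun s => F.1 (p.1, p.2, s)) z| ≤ C)
    {φ ψ : Smooth ℝ} (hf : IsNonCharacteristic f) {u v : Smooth (ℝ × ℝ)}
    (hu : IsSolution F φ ψ f u) (hv : IsSolution F φ ψ f v) : u = v := by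
  have hn := (isCurveFamily_const hf).isNegligible_sub_of_isSolution (c := fun _ => f) F hF hv
    (u := fun _ => u) fun _ => hu
  ext p
  obtain ⟨D, hD, h⟩ := (bigO_of_isNegligible
    (fun _ => (contDiff_coe u).sub (contDiff_coe v)) hn 1 0).bound_zero
    (isCompact_singleton (x := p))
  by_contra hne
  have hpos : 0 < |u.1 p - v.1 p| := abs_pos.2 (sub_ne_zero.2 hne)
  obtain ⟨ε, h1, h2⟩ := (h.and (eventually_mul_lt D hpos)).exists
  have := h1 p rfl
  rw [pow_one] at this
  exact absurd h2 (not_lt.2 this)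

theorem cls_eq_ofSmooth_iff {E : Type} [NormedAddCommGroup E] [NormedSpace ℝ E] (u : Moderate E)
    (v : Smooth E) : cls u = ofSmooth v ↔ IsNegligible fun ε x => (u.1 ε).1 x - v.1 x :=
  Ideal.Quotient.eq

end Comparison

end Colombeau

/-! ### The main theorem -/

open Colombeau in
theorem mainTheorem3
    (F : Colombeau.Smooth (ℝ × ℝ × ℝ))
    (hF : ∀ K : Set (ℝ × ℝ), IsCompact K →
      ∃ C : ℝ, ∀ p ∈ K, ∀ z : ℝ, |deriv (fun s => F.1 (p.1, p.2, s)) z| ≤ C)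
    (φ ψ f : Colombeau.Smooth ℝ) (hf : Colombeau.IsNonCharacteristic f) :
    ∃ v : Colombeau.Smooth (ℝ × ℝ),
      Colombeau.IsSolution F φ ψ f v ∧
      (∀ v', Colombeau.IsSolution F φ ψ f v' → v' = v) ∧
      ∀ g : Colombeau.Moderate ℝ, Colombeau.cls g = Colombeau.ofSmooth f →
        (∀ ε, Colombeau.IsNonCharacteristic (g.1 ε) →
          ∃! u, Colombeau.IsSolution F φ ψ (g.1 ε) u) ∧
        (∀ u : Colombeau.Idx → Colombeau.Smooth (ℝ × ℝ),
          (∀ ε, Colombeau.IsSolution F φ ψ (g.1 ε) (u ε)) →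
            ∃ hu : u ∈ Colombeau.Moderate (ℝ × ℝ),
              Colombeau.IsGeneralizedSolution F φ ψ g.1 (Colombeau.cls ⟨u, hu⟩) ∧
              Colombeau.cls ⟨u, hu⟩ = Colombeau.ofSmooth v) ∧
        (∀ U : Colombeau.Gs (ℝ × ℝ),
          Colombeau.IsGeneralizedSolution F φ ψ g.1 U → U = Colombeau.ofSmooth v) := by
  obtain ⟨v, hv⟩ := exists_isSolution F hF φ ψ f hf
  refine ⟨v, hv, fun v' hv' => isSolution_unique F hF hf hv' hv, fun g hg => ?_⟩
  -- Equality of classes enters only here, as negligibility of f_ε - f.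
  have hc : IsCurveFamily f fun ε => (g.1 ε).1 :=
    ⟨hf, fun ε => (g.1 ε).2, bigO_of_isNegligible
      (fun ε => (contDiff_coe (g.1 ε)).sub (contDiff_coe f))
      ((cls_eq_ofSmooth_iff _ _).1 hg)⟩
  refine ⟨fun ε hε => ?_, fun u hu => ?_, ?_⟩
  · obtain ⟨u, hu⟩ := exists_isSolution F hF φ ψ (g.1 ε) hε
    exact ⟨u, hu, fun u' hu' => isSolution_unique F hF hε hu' hu⟩
  · have hn := hc.isNegligible_sub_of_isSolution F hF hv hu
    have hmod : u ∈ Moderate (ℝ × ℝ) := isModerate_of_isNegligible_sub hn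
    exact ⟨hmod, ⟨⟨u, hmod⟩, rfl,
      isNegligible_of_eq_zero fun ε p => sub_eq_zero.2 ((hu ε).1 p.1 p.2),
      isNegligible_of_eq_zero fun ε x => sub_eq_zero.2 ((hu ε).2.1 x),
      isNegligible_of_eq_zero fun ε x => sub_eq_zero.2 ((hu ε).2.2 x)⟩,
      (cls_eq_ofSmooth_iff _ _).2 hn⟩
  · rintro U ⟨u, rfl, n₁, n₂, n₃⟩
    exact (cls_eq_ofSmooth_iff _ _).2 (hc.isNegligible_sub F hF hv n₁ n₂ n₃)
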